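/- Let $\gamma>-\frac12$. Let $\{W(t):t\ge 0\}$ be a standard Wiener process, and let $\{B(t):0\le t\le 1\}$ be a standard Brownian bridge (a centered Gaussian process with continuous paths and covariance $s\wedge t-st$, i.e. $B\stackrel{\text{law}}{=}\{W(t)-tW(1)\}$). For $t\in[0,1]$ put $$W_\gamma(t)=\frac{1}{\sqrt{1+2\gamma}}\Big\{W(t^{1+2\gamma})-\int_0^1W(u^{1+2\gamma})\,du\Big\},\qquad B^{(\gamma)}(t)=t^\gamma B(t),$$ with $B^{(\gamma)}(0)=0$. For a centered Gaussian process $\zeta$ on $[0,1]$ whose covariance function $K_\zeta(s,t)=E(\zeta(s)\zeta(t))$ is in $L^2([0,1]^2)$, its Karhunen–Loève (KL) eigenvalues are the eigenvalues $\lambda_1\ge\lambda_2\ge\dots\ge0$, repeated according to multiplicity, of the operator $T_\zeta h(t)=\int_0^1K_\zeta(s,t)h(s)\,ds$ on $L^2[0,1]$; that is, there is an orthonormal sequence $(e_k)_{k\ge1}$ in $L^2[0,1]$ with $T_\zeta e_k=\lambda_ke_k$ for all $k$, and $T_\zeta h=0$ for every $h\in L^2[0,1]$ orthogonal to all $e_k$.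 Then: (i) almost surely the paths of $W_\gamma$ and $B^{(\gamma)}$ are in $L^2[0,1]$, and their $L^2[0,1]$ norms have the same law: $$\int_0^1W_\gamma(t)^2\,dt\stackrel{\text{law}}{=}\int_0^1t^{2\gamma}B(t)^2\,dt;$$ (ii) equivalently, $W_\gamma$ and $B^{(\gamma)}$ have identical KL eigenvalues: both covariance functions are in $L^2([0,1]^2)$, and the sequences of KL eigenvalues of the two processes (which exist and are unique) coincide; (iii) the following integrals are almost surely well defined and $$\frac{1}{(1+2\gamma)^2}\int_0^1t^{\frac{-2\gamma}{1+2\gamma}}\Big\{W(t)-\frac1{2\gamma+1}\int_0^1s^{\frac{-2\gamma}{1+2\gamma}}W(s)\,ds\Big\}^2dt\;\stackrel{\text{law}}{=}\;\int_0^1t^{2\gamma}\{W(t)-tW(1)\}^2\,dt.$$ -/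

import Mathlib

open MeasureTheory ProbabilityTheory
open scoped NNReal ENNReal unitInterval

noncomputable section

namespace KLWiener

/-- A standard Brownian bridge on `[0, 1]`: a centered Gaussian process with covariance
`min s t - s t` and (almost surely) continuous paths. Its law is that of `W(t) - t W(1)`,
for `W` a standard Wiener process. -/
structure IsBrownianBridge {Ω : Type*} [MeasurableSpace Ω] (B : I → Ω → ℝ) (P : Measure Ω) :
    Prop where
  isGaussianProcess : IsGaussianProcess B P
  integral_eq_zero : ∀ t : I, ∫ ω, B t ω ∂P = 0
  covariance_eq : ∀ s t : I,
    ∫ ω, B s ω * B t ω ∂P = min (s : ℝ) (t : ℝ) - (s : ℝ) * (t : ℝ)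
  continuous_paths : ∀ᵐ ω ∂P, Continuous fun t : I => B t ω

/-- The mean-centered weighted Wiener process
`W_γ(t) = (1 + 2γ)^(-1/2) * (W(t^(1+2γ)) - ∫_0^1 W(u^(1+2γ)) du)`, for `t ∈ [0, 1]`. -/
def meanCenteredWiener {Ω : Type*} (γ : ℝ) (W : ℝ≥0 → Ω → ℝ) (t : I) (ω : Ω) : ℝ :=
  1 / √(1 + 2 * γ) *
    (W (unitInterval.toNNReal t ^ (1 + 2 * γ)) ω
      - ∫ u : I, W (unitInterval.toNNReal u ^ (1 + 2 * γ)) ω)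

/-- The weighted process `t^γ B(t)`, for `t ∈ [0, 1]`. -/
def weightedBridge {Ω : Type*} (γ : ℝ) (B : I → Ω → ℝ) (t : I) (ω : Ω) : ℝ :=
  (t : ℝ) ^ γ * B t ω

/-- Equality in law of the `L²[0, 1]` norms of two processes: the paths of both are almost surely
in `L²[0, 1]`, and the random variables `∫_0^1 ζ₁(t)² dt` and `∫_0^1 ζ₂(t)² dt` have the same
law. -/
structure QuadEq {Ω₁ Ω₂ : Type*} [MeasurableSpace Ω₁] [MeasurableSpace Ω₂]
    (ζ₁ : I → Ω₁ → ℝ) (P₁ : Measure Ω₁) (ζ₂ : I → Ω₂ → ℝ) (P₂ : Measure Ω₂) : Prop where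
  memLp_fst : ∀ᵐ ω ∂P₁, MemLp (fun t : I => ζ₁ t ω) 2 volume
  memLp_snd : ∀ᵐ ω ∂P₂, MemLp (fun t : I => ζ₂ t ω) 2 volume
  identDistrib : IdentDistrib (fun ω => ∫ t : I, ζ₁ t ω ^ 2) (fun ω => ∫ t : I, ζ₂ t ω ^ 2) P₁ P₂

/-- The covariance function `K(s, t) = E(ζ(s) ζ(t))` of a centered process. -/
def covKernel {Ω : Type*} [MeasurableSpace Ω] (ζ : I → Ω → ℝ) (P : Measure Ω) (s t : I) : ℝ :=
  ∫ ω, ζ s ω * ζ t ω ∂P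

/-- The Fredholm transform `T h(t) = ∫_0^1 K(s, t) h(s) ds` with kernel the covariance function
of the process `ζ`. -/
def fredholm {Ω : Type*} [MeasurableSpace Ω] (ζ : I → Ω → ℝ) (P : Measure Ω) (h : I → ℝ)
    (t : I) : ℝ :=
  ∫ s : I, covKernel ζ P s t * h s

/-- `ev 0 ≥ ev 1 ≥ … ≥ 0` is the sequence of the Karhunen-Loève eigenvalues of the centered process
`ζ` (with square-integrable covariance function): the eigenvalues, counted with multiplicity, of
the Fredholm operator `T` of `ζ` on `L²[0, 1]`. That is, there is an orthonormal sequence `e` in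
`L²[0, 1]` with `T (e k) = ev k • e k` for all `k`, which is exhaustive in the sense that `T`
vanishes on the orthogonal complement of all `e k`. -/
structure IsKLEigenvalues {Ω : Type*} [MeasurableSpace Ω] (ζ : I → Ω → ℝ) (P : Measure Ω)
    (ev : ℕ → ℝ) : Prop where
  memLp_covKernel :
    MemLp (fun p : I × I => covKernel ζ P p.1 p.2) 2 (volume : Measure (I × I))
  antitone : Antitone ev
  nonneg : ∀ k, 0 ≤ ev k
  exists_eigenfunctions : ∃ e : ℕ → Lp ℝ 2 (volume : Measure I), Orthonormal ℝ e ∧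
    (∀ k, ∀ᵐ t : I, fredholm ζ P (e k) t = ev k * e k t) ∧
    ∀ h : Lp ℝ 2 (volume : Measure I), (∀ k, inner ℝ (e k) h = 0) →
      ∀ᵐ t : I, fredholm ζ P h t = 0

end KLWiener

end

/-! The heuristic `W(t^(1+2γ)) / √(1+2γ) ≅ ∫_0^t x^γ dW(x)` suggests the operator `A` on `L²[0,1]`
with kernel `κ(t,x) = x^γ (1_{x ≤ t} - (1 - x))`, the Volterra kernel `x^γ 1_{x ≤ t}` minus its mean
over `t`. The kernel is square integrable because `2γ > -1`. Two direct computations show that `∫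
κ(s,x) κ(t,x) dx` is the covariance of `W_γ` and `∫ κ(t,x) κ(t,y) dt` is that of `t^γ B(t)`
(`covKernel_meanCenteredWiener` with `integral_centeredVolterraKernel_right`;
`integral_centeredVolterraKernel_left`). So the covariance operators are `A A†` and `A† A`.

These have the same nonzero spectrum. Moreover `A` is injective, so all eigenvalues of `A† A` are
positive and `e_k ↦ A e_k / √μ_k` turns a full eigensystem of `A† A` into one of `A A†`
(`IsEigenSystem.exists_apply_adjoint`). Existence comes from compactness of the Hilbert-Schmidt
operator `A` and successive maximization (`exists_isEigenSystem`), uniqueness from the min-max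
principle (`IsEigenSystem.le`). This is the equality of KL eigenvalues.

For the laws, each path is seen as a random element `Z` of `L²[0,1]` with characteristic functional
`exp(-⟨h, S h⟩ / 2)`. The coordinates of `Z` along the eigenvectors have a joint law determined by
the eigenvalues alone, and almost surely `Z` has no component orthogonal to them. Hence `‖Z‖²` is
the almost sure limit of sums of squares whose laws depend only on the eigenvalues
(`HasCovarianceOperator.identDistrib_norm_sq`). The explicit identity is the case `B(t) = W(t) - t
W(1)`, after the substitution `s = t^(1+2γ)`. -/

noncomputable section

namespace KLWiener

/-! ### Eigensystems: uniqueness, transfer from `A† A` to `A A†`, existence -/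

section EigenSystem

variable {H F : Type*} [NormedAddCommGroup H] [InnerProductSpace ℝ H]
  [NormedAddCommGroup F] [InnerProductSpace ℝ F]

/-- `μ` and `e` are the ordered eigenvalues and the eigenvectors of an operator `S` that vanishes on
the orthogonal complement of all `e k`. -/
structure IsEigenSystem (S : H →L[ℝ] H) (μ : ℕ → ℝ) (e : ℕ → H) : Prop where
  antitone : Antitone μ
  nonneg : ∀ k, 0 ≤ μ k
  orthonormal : Orthonormal ℝ e
  apply_eq : ∀ k, S (e k) = μ k • e k
  apply_eq_zero : ∀ h, (∀ k, inner ℝ (e k) h = 0) → S h = 0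

/-- Bessel's inequality makes the expansion converge, and `w` is the remainder. The family `e` need
not be complete, since an eigensystem may leave out part of the kernel of `S`. -/
theorem _root_.Orthonormal.exists_hasSum_sub [CompleteSpace H] {e : ℕ → H} (he : Orthonormal ℝ e)
    (v : H) :
    ∃ w, (∀ k, inner ℝ (e k) w = 0) ∧ HasSum (fun k => inner ℝ (e k) v • e k) (v - w) := by
  have hs : Summable fun k => inner ℝ (e k) v • e k := by
    have h1 := he.orthogonalFamily.summable_iff_norm_sq_summable
      (fun k => (inner ℝ (e k) v : ℝ))
    have h2 := h1.2 (by simpa using he.inner_products_summable v)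
    simpa using h2
  refine ⟨v - ∑' k, inner ℝ (e k) v • e k, fun k => ?_, by simpa using hs.hasSum⟩
  rw [inner_sub_right, sub_eq_zero]
  have h3 : HasSum (fun j => inner ℝ (e k) (inner ℝ (e j) v • e j))
      (inner ℝ (e k) (∑' k, inner ℝ (e k) v • e k)) :=
    hs.hasSum.mapL (innerSL ℝ (e k))
  have h4 : HasSum (fun j => inner ℝ (e k) (inner ℝ (e j) v • e j)) (inner ℝ (e k) v) := by
    convert hasSum_ite_eq k (inner ℝ (e k) v) using 2 with j
    rw [inner_smul_right, orthonormal_iff_ite.1 he k j]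
    by_cases hjk : j = k
    · subst hjk; simp
    · simp [hjk, Ne.symm hjk]
  exact h4.unique h3

/-- The remainder `w` is killed by `S`, so the quadratic form is diagonal. Only the right argument
is expanded, hence no symmetry of `S` is needed. -/
theorem IsEigenSystem.hasSum_inner_apply [CompleteSpace H] {S : H →L[ℝ] H} {μ : ℕ → ℝ} {e : ℕ → H}
    (h : IsEigenSystem S μ e) (v : H) :
    HasSum (fun k => μ k * inner ℝ (e k) v ^ 2) (inner ℝ v (S v)) := by
  obtain ⟨w, hw, hs⟩ := h.orthonormal.exists_hasSum_sub v
  have h1 : HasSum (fun k => inner ℝ v (S (inner ℝ (e k) v • e k))) (inner ℝ v (S (v - w))) :=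
    hs.mapL ((innerSL ℝ v).comp S)
  rw [map_sub, h.apply_eq_zero w hw, sub_zero] at h1
  convert h1 using 2 with k
  rw [map_smul, h.apply_eq, inner_smul_right, inner_smul_right, real_inner_comm]
  ring

/-- Courant-Fischer comparison: the span of `e 0, …, e k` has one dimension too many to avoid the
orthogonal complement of `f 0, …, f (k - 1)`. On a common nonzero vector the Rayleigh quotient is at
least `μ k` and at most `ν k`. -/
theorem IsEigenSystem.le [CompleteSpace H] {S : H →L[ℝ] H} {μ ν : ℕ → ℝ} {e f : ℕ → H}
    (h : IsEigenSystem S μ e) (h' : IsEigenSystem S ν f) (k : ℕ) : μ k ≤ ν k := by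
  -- a nonzero combination of `e 0, …, e k` that is orthogonal to `f 0, …, f (k - 1)`
  obtain ⟨c, hc0, hc⟩ : ∃ c : Fin (k + 1) → ℝ, c ≠ 0 ∧
      ∀ j : Fin k, inner ℝ (f j) (∑ i, c i • e i) = 0 := by
    let L : (Fin (k + 1) → ℝ) →ₗ[ℝ] (Fin k → ℝ) :=
      { toFun := fun c j => inner ℝ (f j) (∑ i, c i • e i)
        map_add' := fun c d => by
          ext j
          simp [add_smul, Finset.sum_add_distrib, inner_add_right]
        map_smul' := fun r c => by
          ext j
          simp [mul_smul, ← Finset.smul_sum, inner_smul_right] }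
    obtain ⟨c, hc, hc0⟩ := (Submodule.ne_bot_iff _).1
      (LinearMap.ker_ne_bot_of_finrank_lt (f := L) (by simp))
    exact ⟨c, hc0, fun j => congrFun (LinearMap.mem_ker.1 hc) j⟩
  set v := ∑ i, c i • e i with hv
  have he' : Orthonormal ℝ fun i : Fin (k + 1) => e i := h.orthonormal.comp _ Fin.val_injective
  have hnorm : inner ℝ v v = ∑ i, c i ^ 2 := by
    rw [hv, he'.inner_sum]
    simp [sq]
  have hpos : 0 < ∑ i, c i ^ 2 := by
    obtain ⟨i, hi⟩ := Function.ne_iff.1 hc0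
    have hi' : c i ≠ 0 := hi
    exact Finset.sum_pos' (fun i _ => sq_nonneg _)
      ⟨i, Finset.mem_univ _, by positivity⟩
  have hlow : μ k * ∑ i, c i ^ 2 ≤ inner ℝ v (S v) := by
    have : inner ℝ v (S v) = ∑ i : Fin (k + 1), μ i * c i ^ 2 := by
      have : S v = ∑ i : Fin (k + 1), (μ i * c i) • e i := by
        rw [hv, map_sum]
        refine Finset.sum_congr rfl fun i _ => ?_
        rw [map_smul, h.apply_eq, smul_smul, mul_comm]
      rw [this, hv, he'.inner_sum]
      refine Finset.sum_congr rfl fun i _ => ?_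
      simp only [conj_trivial]
      ring
    rw [this, Finset.mul_sum]
    refine Finset.sum_le_sum fun i _ => ?_
    exact mul_le_mul_of_nonneg_right (h.antitone (Nat.lt_succ_iff.1 i.2)) (sq_nonneg _)
  -- In the expansion along `f` the terms with `j < k` vanish and the others have `ν j ≤ ν k`;
  -- Bessel's inequality bounds the rest.
  have hup : inner ℝ v (S v) ≤ ν k * ∑ i, c i ^ 2 := by
    have h1 := h'.hasSum_inner_apply v
    have h2 := (h'.orthonormal.inner_products_summable v).mul_left (ν k)
    have h3 := h'.orthonormal.tsum_inner_products_le v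
    rw [← real_inner_self_eq_norm_sq, hnorm] at h3
    refine le_trans ?_ (mul_le_mul_of_nonneg_left h3 (h'.nonneg k))
    rw [← h1.tsum_eq, ← tsum_mul_left]
    refine h1.summable.tsum_le_tsum (fun j => ?_) h2
    rcases lt_or_ge j k with hj | hj
    · rw [hc ⟨j, hj⟩]; simp
    · rw [Real.norm_eq_abs, sq_abs]
      exact mul_le_mul_of_nonneg_right (h'.antitone hj) (sq_nonneg _)
  exact le_of_mul_le_mul_right (hlow.trans hup) hpos

theorem IsEigenSystem.unique [CompleteSpace H] {S : H →L[ℝ] H} {μ ν : ℕ → ℝ} {e f : ℕ → H}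
    (h : IsEigenSystem S μ e) (h' : IsEigenSystem S ν f) : μ = ν :=
  funext fun k => (h.le h' k).antisymm (h'.le h k)

open ContinuousLinearMap in
/-- The singular values of an injective operator `A` are the same for `A† A` and `A A†`. -/
theorem IsEigenSystem.exists_apply_adjoint [CompleteSpace H] [CompleteSpace F] {A : H →L[ℝ] F}
    (hA : Function.Injective A) {μ : ℕ → ℝ} {e : ℕ → H} (h : IsEigenSystem (adjoint A ∘L A) μ e) :
    ∃ f, IsEigenSystem (A ∘L adjoint A) μ f := by
  have hin : ∀ j k, inner ℝ (A (e j)) (A (e k)) = if j = k then μ k else 0 := by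
    intro j k
    have := h.apply_eq k
    rw [comp_apply] at this
    rw [← adjoint_inner_right, this, inner_smul_right, orthonormal_iff_ite.1 h.orthonormal]
    simp
  -- Since `μ k = ‖A (e k)‖²`, injectivity excludes zero eigenvalues, whose eigenvectors could not
  -- be normalized after applying `A`.
  have hpos : ∀ k, 0 < μ k := by
    intro k
    have := hin k k
    rw [if_pos rfl] at this
    rw [← this, real_inner_self_pos]
    intro h0
    exact h.orthonormal.ne_zero k (hA (by simpa using h0))
  have hs : ∀ k, √(μ k) * √(μ k) = μ k := fun k => Real.mul_self_sqrt (h.nonneg k)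
  have hs0 : ∀ k, √(μ k) ≠ 0 := fun k => (Real.sqrt_pos.2 (hpos k)).ne'
  refine ⟨fun k => (√(μ k))⁻¹ • A (e k), h.antitone, h.nonneg, ?_, fun k => ?_, fun g hg => ?_⟩
  · rw [orthonormal_iff_ite]
    intro j k
    rw [inner_smul_left, inner_smul_right, hin]
    by_cases hjk : j = k
    · subst hjk
      have := hs j
      have := hs0 j
      simp only [if_true, conj_trivial]
      field_simp
      linarith [hs j]
    · simp [hjk]
  · have := h.apply_eq k
    rw [comp_apply] at this
    rw [comp_apply, map_smul, map_smul, this, map_smul, smul_comm]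
  · have h1 : ∀ k, inner ℝ (e k) (adjoint A g) = 0 := by
      intro k
      have := hg k
      rw [inner_smul_left] at this
      rw [adjoint_inner_right]
      simpa [hs0 k] using this
    have h2 := h.apply_eq_zero _ h1
    rw [comp_apply] at h2 ⊢
    have h3 : inner ℝ (A (adjoint A g)) (A (adjoint A g)) = (0 : ℝ) := by
      rw [← adjoint_inner_right, h2, inner_zero_right]
    exact inner_self_eq_zero.1 h3

open ContinuousLinearMap in
/-- A compact operator attains its norm on the unit sphere. -/
theorem _root_.IsCompactOperator.exists_norm_eq_opNorm [CompleteSpace H] [CompleteSpace F]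
    [Nontrivial H] {B : H →L[ℝ] F} (hB : IsCompactOperator B) : ∃ x, ‖x‖ = 1 ∧ ‖B x‖ = ‖B‖ := by
  rcases eq_or_ne B 0 with rfl | hB0
  · obtain ⟨x, hx⟩ := exists_norm_eq H zero_le_one
    exact ⟨x, hx, by simp⟩
  have hBpos : 0 < ‖B‖ := norm_pos_iff.2 hB0
  have hK := hB.isCompact_closure_image_closedBall (f := B.toLinearMap) 1
  set K := closure (B '' Metric.closedBall 0 1) with hKdef
  have hne : K.Nonempty := ⟨B 0, subset_closure ⟨0, by simp, rfl⟩⟩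
  -- The maximum is taken over the closure of the image of the ball, so `y` is not yet known to be a
  -- value of `B`; the preimage will be `B† y / ‖B‖²`.
  obtain ⟨y, hyK, hy⟩ := hK.exists_isMaxOn hne continuous_norm.continuousOn
  have hyle : ‖y‖ ≤ ‖B‖ := by
    have : K ⊆ Metric.closedBall 0 ‖B‖ := by
      refine closure_minimal ?_ Metric.isClosed_closedBall
      rintro _ ⟨x, hx, rfl⟩
      simp only [Metric.mem_closedBall, dist_zero_right] at hx ⊢
      simpa using B.le_opNorm_of_le hx
    simpa using this hyK
  have hyge : ‖B‖ ≤ ‖y‖ := by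
    refine B.opNorm_le_of_unit_norm (norm_nonneg _) fun x hx => ?_
    exact hy (subset_closure ⟨x, by simp [hx], rfl⟩)
  have hyB : ‖y‖ = ‖B‖ := le_antisymm hyle hyge
  have hadj : ‖adjoint B y‖ ≤ ‖B‖ ^ 2 := by
    have := (adjoint B).le_opNorm y
    rwa [LinearIsometryEquiv.norm_map, hyB, ← sq] at this
  -- The bound `⟨y, z⟩ ≤ ‖B† y‖` holds for `z` in the image of the ball, passes to the closure, and
  -- is used at `z = y`.
  have hadj' : ‖B‖ ^ 2 ≤ ‖adjoint B y‖ := by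
    have : K ⊆ {z | inner ℝ y z ≤ ‖adjoint B y‖} := by
      refine closure_minimal ?_ (isClosed_le (by fun_prop) continuous_const)
      rintro _ ⟨x, hx, rfl⟩
      simp only [Metric.mem_closedBall, dist_zero_right] at hx
      show inner ℝ y (B x) ≤ _
      rw [← adjoint_inner_left]
      refine (real_inner_le_norm _ _).trans ?_
      exact mul_le_of_le_one_right (norm_nonneg _) hx
    have := this hyK
    rwa [Set.mem_ofPred_eq, real_inner_self_eq_norm_sq, hyB] at this
  have hadje := le_antisymm hadj hadj'
  refine ⟨(‖B‖ ^ 2)⁻¹ • adjoint B y, ?_, ?_⟩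
  · rw [norm_smul, hadje]
    simp [hBpos.ne']
  · refine le_antisymm ?_ ?_
    · have := B.le_opNorm ((‖B‖ ^ 2)⁻¹ • adjoint B y)
      rw [norm_smul (_ : ℝ) (adjoint B y), hadje] at this
      simpa [hBpos.ne'] using this
    · have h1 : inner ℝ y (B ((‖B‖ ^ 2)⁻¹ • adjoint B y)) = ‖B‖ ^ 2 := by
        rw [map_smul, inner_smul_right, ← adjoint_inner_left, real_inner_self_eq_norm_sq, hadje]
        field_simp
      have h2 := real_inner_le_norm y (B ((‖B‖ ^ 2)⁻¹ • adjoint B y))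
      rw [h1, hyB] at h2
      exact le_of_mul_le_mul_left (by rwa [← sq]) hBpos

open ContinuousLinearMap in
-- The restriction of `A` to `Sᗮ` is still compact, and `Sᗮ ≠ 0` because the space is
-- infinite-dimensional.
theorem _root_.IsCompactOperator.exists_isMaxOn_orthogonal [CompleteSpace H] [CompleteSpace F]
    {A : H →L[ℝ] F} (hA : IsCompactOperator A) (hinf : ¬ FiniteDimensional ℝ H)
    (S : Submodule ℝ H) [FiniteDimensional ℝ S] :
    ∃ x ∈ Sᗮ, ‖x‖ = 1 ∧ ∀ y ∈ Sᗮ, ‖A y‖ ≤ ‖A x‖ * ‖y‖ := by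
  have : Nontrivial Sᗮ := by
    rw [Submodule.nontrivial_iff_ne_bot, Ne, Submodule.orthogonal_eq_bot_iff]
    rintro rfl
    exact hinf (Module.Finite.equiv (Submodule.topEquiv (R := ℝ) (M := H)))
  have hB : IsCompactOperator (A ∘L Sᗮ.subtypeL) := hA.comp_clm Sᗮ.subtypeL
  obtain ⟨x, hx, hBx⟩ := hB.exists_norm_eq_opNorm
  refine ⟨x, x.2, by simpa using hx, fun y hy => ?_⟩
  have := (A ∘L Sᗮ.subtypeL).le_opNorm ⟨y, hy⟩
  rw [← hBx] at this
  simpa using this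

open ContinuousLinearMap in
/-- If `x` maximizes `‖A x‖` on the unit sphere of a subspace that is invariant under `A† A`, then
`x` is an eigenvector. -/
theorem adjoint_apply_eq_of_isMaxOn [CompleteSpace H] [CompleteSpace F] {A : H →L[ℝ] F}
    {U : Submodule ℝ H} (hU : ∀ v ∈ U, adjoint A (A v) ∈ U) {x : H} (hxU : x ∈ U) (hx : ‖x‖ = 1)
    (hmax : ∀ y ∈ U, ‖A y‖ ≤ ‖A x‖ * ‖y‖) : adjoint A (A x) = ‖A x‖ ^ 2 • x := by
  set y := adjoint A (A x) with hy
  have h1 : ‖y‖ ^ 2 ≤ ‖A x‖ ^ 2 * ‖y‖ := by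
    have : inner ℝ y y = inner ℝ (A x) (A y) := adjoint_inner_left A y (A x)
    rw [← real_inner_self_eq_norm_sq, this]
    refine (real_inner_le_norm _ _).trans ?_
    have := mul_le_mul_of_nonneg_left (hmax y (hU x hxU)) (norm_nonneg (A x))
    linarith
  have h2 : ‖y‖ ≤ ‖A x‖ ^ 2 := by
    rcases (norm_nonneg y).eq_or_lt with h | h
    · rw [← h]; positivity
    · rw [sq] at h1; exact le_of_mul_le_mul_right h1 h
  have h3 : inner ℝ y x = ‖A x‖ ^ 2 := by
    rw [hy, adjoint_inner_left, real_inner_self_eq_norm_sq]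
  -- With `c = ‖A x‖²`, the square expands to `‖y‖² - 2c² + c²`, and `‖y‖ ≤ c`.
  have h4 : ‖y - ‖A x‖ ^ 2 • x‖ ^ 2 ≤ 0 := by
    rw [norm_sub_sq_real, inner_smul_right, h3, norm_smul, hx]
    simp only [norm_pow, norm_norm, mul_one]
    nlinarith [norm_nonneg y]
  have h5 : ‖y - ‖A x‖ ^ 2 • x‖ = 0 := by
    have := sq_nonneg ‖y - ‖A x‖ ^ 2 • x‖
    exact pow_eq_zero_iff two_ne_zero |>.1 (le_antisymm h4 this)
  exact sub_eq_zero.1 (norm_eq_zero.1 h5)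

open ContinuousLinearMap in
/-- Spectral theorem for `A† A`, with `A` a Hilbert-Schmidt operator. -/
theorem exists_isEigenSystem [CompleteSpace H] [CompleteSpace F] {A : H →L[ℝ] F}
    (hA : IsCompactOperator A) (hinf : ¬ FiniteDimensional ℝ H)
    (hHS : ∀ e : ℕ → H, Orthonormal ℝ e → Summable fun k => ‖A (e k)‖ ^ 2) :
    ∃ μ e, IsEigenSystem (adjoint A ∘L A) μ e := by
  have key := fun S : {S : Submodule ℝ H // FiniteDimensional ℝ S} =>
    have := S.2
    hA.exists_isMaxOn_orthogonal hinf S.1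
  choose next hnext_mem hnext_norm hnext_max using key
  -- `S n` is the span of the first `n` vectors chosen; `e n` maximizes `‖A x‖` on the unit sphere
  -- of its orthogonal complement.
  obtain ⟨S, hS0, hS⟩ : ∃ S : ℕ → {S : Submodule ℝ H // FiniteDimensional ℝ S},
      (S 0).1 = ⊥ ∧ ∀ n, (S (n + 1)).1 = (S n).1 ⊔ Submodule.span ℝ {next (S n)} :=
    ⟨fun n => Nat.rec ⟨⊥, inferInstance⟩
      (fun _ T => have := T.2; ⟨T.1 ⊔ Submodule.span ℝ {next T}, inferInstance⟩) n,
      rfl, fun _ => rfl⟩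
  obtain ⟨e, he⟩ : ∃ e : ℕ → H, ∀ n, e n = next (S n) := ⟨_, fun _ => rfl⟩
  simp only [← he] at hS
  replace hnext_mem : ∀ n, e n ∈ (S n).1ᗮ := fun n => he n ▸ hnext_mem _
  replace hnext_norm : ∀ n, ‖e n‖ = 1 := fun n => he n ▸ hnext_norm _
  replace hnext_max : ∀ n, ∀ y ∈ (S n).1ᗮ, ‖A y‖ ≤ ‖A (e n)‖ * ‖y‖ := fun n => he n ▸ hnext_max _
  have hmono : Monotone fun n => (S n).1 := monotone_nat_of_le_succ fun n => by
    rw [hS]; exact le_sup_left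
  have hmem : ∀ m n, m < n → e m ∈ (S n).1 := fun m n hmn => by
    refine hmono (Nat.succ_le_of_lt hmn) ?_
    show e m ∈ (S (m + 1)).1
    rw [hS]
    exact Submodule.mem_sup_right (Submodule.mem_span_singleton_self _)
  have horth : Orthonormal ℝ e := by
    refine ⟨fun n => hnext_norm _, fun m n hmn => ?_⟩
    rcases lt_or_gt_of_ne hmn with h | h
    · exact hnext_mem n _ (hmem m n h)
    · rw [real_inner_comm]
      exact hnext_mem m _ (hmem n m h)
  -- Invariance of `S n` passes to its complement by self-adjointness of `A† A`, which makes `e n`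
  -- an eigenvector, which in turn makes `S (n + 1)` invariant; hence the joint induction.
  have hinv : ∀ n, (∀ v ∈ (S n).1, adjoint A (A v) ∈ (S n).1) ∧
      adjoint A (A (e n)) = ‖A (e n)‖ ^ 2 • e n := by
    have step : ∀ n, (∀ v ∈ (S n).1, adjoint A (A v) ∈ (S n).1) →
        adjoint A (A (e n)) = ‖A (e n)‖ ^ 2 • e n := by
      intro n h
      refine adjoint_apply_eq_of_isMaxOn (U := (S n).1ᗮ) (fun v hv u hu => ?_)
        (hnext_mem _) (hnext_norm _) (hnext_max _)
      rw [adjoint_inner_right, ← adjoint_inner_left]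
      exact hv _ (h u hu)
    intro n
    induction n with
    | zero =>
      have : ∀ v ∈ (S 0).1, adjoint A (A v) ∈ (S 0).1 := by
        intro v hv
        rw [hS0, Submodule.mem_bot] at hv
        simp [hv]
      exact ⟨this, step 0 this⟩
    | succ n ih =>
      have : ∀ v ∈ (S (n + 1)).1, adjoint A (A v) ∈ (S (n + 1)).1 := by
        intro v hv
        rw [hS, Submodule.mem_sup] at hv
        obtain ⟨u, hu, w, hw, rfl⟩ := hv
        obtain ⟨c, rfl⟩ := Submodule.mem_span_singleton.1 hw
        rw [map_add, map_add, map_smul, map_smul, ih.2]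
        refine add_mem (hmono n.le_succ (ih.1 u hu)) ?_
        exact Submodule.smul_mem _ _ (Submodule.smul_mem _ _ (hmem n _ n.lt_succ_self))
      exact ⟨this, step _ this⟩
  have hanti : Antitone fun n => ‖A (e n)‖ := antitone_nat_of_succ_le fun n => by
    have := hnext_max n (e (n + 1))
      (Submodule.orthogonal_le (hmono n.le_succ) (hnext_mem (n + 1)))
    rwa [hnext_norm, mul_one] at this
  refine ⟨fun n => ‖A (e n)‖ ^ 2, e, fun m n hmn => ?_, fun _ => sq_nonneg _, horth,
    fun k => by rw [comp_apply, (hinv k).2], fun h hh => ?_⟩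
  · exact pow_le_pow_left₀ (norm_nonneg _) (hanti hmn) 2
  · have hh' : ∀ n, h ∈ (S n).1ᗮ := by
      intro n
      induction n with
      | zero => rw [hS0]; simp
      | succ n ih =>
        rw [hS, ← Submodule.inf_orthogonal]
        exact ⟨ih, Submodule.mem_orthogonal_singleton_iff_inner_right.2 (hh n)⟩
    have h0 : Filter.Tendsto (fun n => ‖A (e n)‖ ^ 2) Filter.atTop (nhds 0) :=
      (hHS e horth).tendsto_atTop_zero
    -- A vector orthogonal to every `e n` competes in every maximization, so `‖A h‖ ≤ ‖A (e n)‖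
    -- ‖h‖`, which tends to zero.
    have h1 : ‖A h‖ ^ 2 ≤ 0 := by
      refine ge_of_tendsto' (x := Filter.atTop) (f := fun n => ‖A (e n)‖ ^ 2 * ‖h‖ ^ 2) ?_
        (fun n => ?_)
      · simpa using h0.mul_const (‖h‖ ^ 2)
      · rw [← mul_pow]
        exact pow_le_pow_left₀ (norm_nonneg _) (hnext_max n h (hh' n)) 2
    have h2 : A h = 0 := by
      rw [← norm_eq_zero]
      exact pow_eq_zero_iff two_ne_zero |>.1 (le_antisymm h1 (sq_nonneg _))
    rw [comp_apply, h2, map_zero]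

end EigenSystem

/-! ### Gaussian random elements of a Hilbert space and the law of their norm -/

section GaussianElement

open Filter Topology

variable {Ω Ω' H H' : Type*} [MeasurableSpace Ω] [MeasurableSpace Ω']
  [NormedAddCommGroup H] [InnerProductSpace ℝ H] [NormedAddCommGroup H'] [InnerProductSpace ℝ H']

/-- `Z` is a weakly measurable centered Gaussian random element of `H` with covariance operator
`S`. -/
structure HasCovarianceOperator (Z : Ω → H) (P : Measure Ω) (S : H →L[ℝ] H) : Prop where
  aemeasurable_inner : ∀ h, AEMeasurable (fun ω => inner ℝ h (Z ω)) P
  integral_cexp_inner : ∀ h, ∫ ω, Complex.exp ((inner ℝ h (Z ω) : ℝ) * Complex.I) ∂P =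
    Complex.exp (-(inner ℝ h (S h) : ℝ) / 2)

variable {P : Measure Ω} {P' : Measure Ω'} {Z : Ω → H} {Z' : Ω' → H'} {S : H →L[ℝ] H}
  {S' : H' →L[ℝ] H'} {μ : ℕ → ℝ} {e : ℕ → H} {e' : ℕ → H'}

/-- The characteristic function of `⟨h, Z⟩` is constantly `1`, because `S (t • h) = 0` for all `t`.
-/
theorem HasCovarianceOperator.ae_inner_eq_zero [IsProbabilityMeasure P]
    (hZ : HasCovarianceOperator Z P S) {h : H} (hh : S h = 0) : ∀ᵐ ω ∂P, inner ℝ h (Z ω) = 0 := by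
  have hm := hZ.aemeasurable_inner h
  have : IsProbabilityMeasure (P.map fun ω => inner ℝ h (Z ω)) := Measure.isProbabilityMeasure_map hm
  have hlaw : P.map (fun ω => inner ℝ h (Z ω)) = Measure.dirac 0 := by
    refine Measure.ext_of_charFun (funext fun t => ?_)
    rw [charFun_apply, charFun_dirac, integral_map hm (by fun_prop)]
    have := hZ.integral_cexp_inner (t • h)
    rw [map_smul, hh] at this
    simp only [inner_smul_left, smul_zero, inner_zero_right, conj_trivial] at this
    simpa using this
  have h0 : ∀ᵐ x ∂(P.map fun ω => inner ℝ h (Z ω)), x = 0 := by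
    rw [hlaw]
    exact (ae_dirac_iff (measurableSet_singleton (0 : ℝ))).2 rfl
  exact ae_of_ae_map hm h0

/-- Each `h` orthogonal to all `e k` satisfies `⟨h, Z⟩ = 0` off a null set depending on `h`.
Separability reduces to countably many `h`, so almost surely `Z` is orthogonal to its own remainder
and Parseval's identity holds although `e` may be incomplete. -/
theorem HasCovarianceOperator.ae_hasSum [IsProbabilityMeasure P] [CompleteSpace H]
    [SecondCountableTopology H] (hZ : HasCovarianceOperator Z P S) (he : IsEigenSystem S μ e) :
    ∀ᵐ ω ∂P, HasSum (fun k => inner ℝ (e k) (Z ω) ^ 2) (‖Z ω‖ ^ 2) := by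
  obtain ⟨D, hDc, hD⟩ := TopologicalSpace.exists_countable_dense {h : H // ∀ k, inner ℝ (e k) h = 0}
  have h1 : ∀ᵐ ω ∂P, ∀ h ∈ D, inner ℝ h.1 (Z ω) = 0 :=
    (ae_ball_iff hDc).2 fun h _ => hZ.ae_inner_eq_zero (he.apply_eq_zero _ h.2)
  filter_upwards [h1] with ω hω
  obtain ⟨w, hw, hs⟩ := he.orthonormal.exists_hasSum_sub (Z ω)
  have hwZ : inner ℝ w (Z ω) = 0 := by
    have hcl : IsClosed {h : {h : H // ∀ k, inner ℝ (e k) h = 0} | inner ℝ h.1 (Z ω) = 0} :=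
      isClosed_eq (by fun_prop) continuous_const
    have := closure_minimal (show D ⊆ _ from fun h hh => hω h hh) hcl
    rw [hD.closure_eq] at this
    exact this (Set.mem_univ ⟨w, hw⟩)
  have h2 := hs.mapL (innerSL ℝ (Z ω))
  have h3 : innerSL ℝ (Z ω) (Z ω - w) = ‖Z ω‖ ^ 2 := by
    rw [innerSL_apply_apply, inner_sub_right, real_inner_comm w, hwZ, real_inner_self_eq_norm_sq]
    simp
  rw [h3] at h2
  refine h2.congr_fun fun k => ?_
  rw [innerSL_apply_apply, inner_smul_right, real_inner_comm, sq]

/-- The coordinates are independent centered Gaussians with variances `μ k`; what matters is that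
the right-hand side mentions neither `Z` nor `e`. -/
theorem HasCovarianceOperator.charFun_map [IsProbabilityMeasure P]
    (hZ : HasCovarianceOperator Z P S) (he : IsEigenSystem S μ e) (n : ℕ)
    (u : EuclideanSpace ℝ (Fin n)) :
    charFun (P.map fun ω => WithLp.toLp 2 fun k : Fin n => inner ℝ (e k) (Z ω)) u =
      Complex.exp (-(∑ k : Fin n, μ k * u k ^ 2 : ℝ) / 2) := by
  have hm : AEMeasurable (fun ω => WithLp.toLp 2 fun k : Fin n => (inner ℝ (e k) (Z ω) : ℝ)) P :=
    (WithLp.measurable_toLp 2 _).comp_aemeasurable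
      (aemeasurable_pi_lambda _ fun k => hZ.aemeasurable_inner _)
  rw [charFun_apply, integral_map hm (by fun_prop)]
  have h1 := hZ.integral_cexp_inner (∑ k, u k • e k)
  have he' : Orthonormal ℝ fun i : Fin n => e i := he.orthonormal.comp _ Fin.val_injective
  have h2 : inner ℝ (∑ k, u k • e k) (S (∑ k, u k • e k)) = ∑ k : Fin n, μ k * u k ^ 2 := by
    have : S (∑ k, u k • e k) = ∑ k : Fin n, (μ k * u k) • e k := by
      rw [map_sum]
      refine Finset.sum_congr rfl fun i _ => ?_
      rw [map_smul, he.apply_eq, smul_smul, mul_comm]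
    rw [this, he'.inner_sum]
    refine Finset.sum_congr rfl fun i _ => ?_
    simp only [conj_trivial]
    ring
  rw [h2] at h1
  rw [← h1]
  congr 1 with ω
  congr 3
  rw [sum_inner, PiLp.inner_apply]
  refine Finset.sum_congr rfl fun i _ => ?_
  simp [inner_smul_left]

theorem HasCovarianceOperator.identDistrib_sum [IsProbabilityMeasure P] [IsProbabilityMeasure P']
    (hZ : HasCovarianceOperator Z P S) (he : IsEigenSystem S μ e)
    (hZ' : HasCovarianceOperator Z' P' S') (he' : IsEigenSystem S' μ e') (n : ℕ) :
    IdentDistrib (fun ω => ∑ k ∈ Finset.range n, inner ℝ (e k) (Z ω) ^ 2)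
      (fun ω => ∑ k ∈ Finset.range n, inner ℝ (e' k) (Z' ω) ^ 2) P P' := by
  have hm : AEMeasurable (fun ω => WithLp.toLp 2 fun k : Fin n => (inner ℝ (e k) (Z ω) : ℝ)) P :=
    (WithLp.measurable_toLp 2 _).comp_aemeasurable
      (aemeasurable_pi_lambda _ fun k => hZ.aemeasurable_inner _)
  have hm' : AEMeasurable (fun ω => WithLp.toLp 2 fun k : Fin n => (inner ℝ (e' k) (Z' ω) : ℝ)) P' :=
    (WithLp.measurable_toLp 2 _).comp_aemeasurable
      (aemeasurable_pi_lambda _ fun k => hZ'.aemeasurable_inner _)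
  have hvec : IdentDistrib (fun ω => WithLp.toLp 2 fun k : Fin n => (inner ℝ (e k) (Z ω) : ℝ))
      (fun ω => WithLp.toLp 2 fun k : Fin n => (inner ℝ (e' k) (Z' ω) : ℝ)) P P' := by
    refine ⟨hm, hm', ?_⟩
    have := Measure.isProbabilityMeasure_map hm
    have := Measure.isProbabilityMeasure_map hm'
    refine Measure.ext_of_charFun (funext fun u => ?_)
    rw [hZ.charFun_map he, hZ'.charFun_map he']
  have := hvec.comp (u := fun x : EuclideanSpace ℝ (Fin n) => ∑ k, x k ^ 2) (by fun_prop)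
  simpa [Function.comp_def, Finset.sum_range] using this

theorem tendsto_integral_cexp_of_tendsto_ae [IsProbabilityMeasure P] {X : ℕ → Ω → ℝ} {Y : Ω → ℝ}
    (hX : ∀ n, AEMeasurable (X n) P) (hY : ∀ᵐ ω ∂P, Tendsto (fun n => X n ω) atTop (𝓝 (Y ω)))
    (u : ℝ) : Tendsto (fun n => ∫ ω, Complex.exp ((u * X n ω : ℝ) * Complex.I) ∂P) atTop
      (𝓝 (∫ ω, Complex.exp ((u * Y ω : ℝ) * Complex.I) ∂P)) := by
  have hc : Continuous fun x : ℝ => Complex.exp ((u * x : ℝ) * Complex.I) := by fun_prop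
  refine tendsto_integral_of_dominated_convergence (fun _ => 1) (fun n => ?_)
    (integrable_const _) (fun n => ae_of_all _ fun ω => ?_) ?_
  · exact (hc.measurable.comp_aemeasurable (hX n)).aestronglyMeasurable
  · rw [Complex.norm_exp_ofReal_mul_I]
  · filter_upwards [hY] with ω hω
    exact (hc.tendsto _).comp hω

/-- Equality in law passes to almost sure limits. -/
theorem identDistrib_of_tendsto_ae [IsProbabilityMeasure P] [IsProbabilityMeasure P']
    {X : ℕ → Ω → ℝ} {X' : ℕ → Ω' → ℝ} {Y : Ω → ℝ} {Y' : Ω' → ℝ}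
    (hX : ∀ n, IdentDistrib (X n) (X' n) P P')
    (hY : ∀ᵐ ω ∂P, Tendsto (fun n => X n ω) atTop (𝓝 (Y ω)))
    (hY' : ∀ᵐ ω ∂P', Tendsto (fun n => X' n ω) atTop (𝓝 (Y' ω))) : IdentDistrib Y Y' P P' := by
  have hm : AEMeasurable Y P :=
    aemeasurable_of_tendsto_metrizable_ae' (fun n => (hX n).aemeasurable_fst) hY
  have hm' : AEMeasurable Y' P' :=
    aemeasurable_of_tendsto_metrizable_ae' (fun n => (hX n).aemeasurable_snd) hY'
  refine ⟨hm, hm', ?_⟩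
  have := Measure.isProbabilityMeasure_map hm
  have := Measure.isProbabilityMeasure_map hm'
  refine Measure.ext_of_charFun (funext fun u => ?_)
  simp only [charFun_apply]
  rw [integral_map hm (by fun_prop), integral_map hm' (by fun_prop)]
  have h1 := tendsto_integral_cexp_of_tendsto_ae (fun n => (hX n).aemeasurable_fst) hY u
  have h2 := tendsto_integral_cexp_of_tendsto_ae (fun n => (hX n).aemeasurable_snd) hY' u
  refine tendsto_nhds_unique h1 (h2.congr fun n => ?_)
  exact (((hX n).comp (u := fun x : ℝ => Complex.exp ((u * x : ℝ) * Complex.I))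
    (by fun_prop)).integral_eq).symm

theorem HasCovarianceOperator.identDistrib_norm_sq [IsProbabilityMeasure P]
    [IsProbabilityMeasure P'] [CompleteSpace H] [SecondCountableTopology H] [CompleteSpace H']
    [SecondCountableTopology H'] (hZ : HasCovarianceOperator Z P S) (he : IsEigenSystem S μ e)
    (hZ' : HasCovarianceOperator Z' P' S') (he' : IsEigenSystem S' μ e') :
    IdentDistrib (fun ω => ‖Z ω‖ ^ 2) (fun ω => ‖Z' ω‖ ^ 2) P P' :=
  identDistrib_of_tendsto_ae (hZ.identDistrib_sum he hZ' he')
    ((hZ.ae_hasSum he).mono fun _ h => h.tendsto_sum_nat)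
    ((hZ'.ae_hasSum he').mono fun _ h => h.tendsto_sum_nat)

end GaussianElement

/-! ### Characteristic functions of integrals of Gaussian processes -/

section LinearFunctional

open Filter Topology

variable {Ω : Type*} [MeasurableSpace Ω] {P : Measure Ω}

theorem integral_cexp_sum_of_isGaussianProcess {T : Type*} {X : T → Ω → ℝ}
    (hX : IsGaussianProcess X P) (h0 : ∀ t, ∫ ω, X t ω ∂P = 0) (F : Finset T) (c : T → ℝ) :
    ∫ ω, Complex.exp ((∑ t ∈ F, X t ω * c t : ℝ) * Complex.I) ∂P =
      Complex.exp (-(∑ s ∈ F, ∑ t ∈ F, (∫ ω, X s ω * X t ω ∂P) * c s * c t : ℝ) / 2) := by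
  have := hX.isProbabilityMeasure
  have h2 : ∀ t, MemLp (X t) 2 P := fun t => (hX.hasGaussianLaw_eval t).memLp_two
  have hint : ∀ s t, Integrable (fun ω => X s ω * X t ω) P := fun s t =>
    (h2 s).integrable_mul (h2 t)
  have hlaw : HasGaussianLaw (fun ω => ∑ t ∈ F, X t ω * c t) P := by
    have := (hX.hasGaussianLaw F).map (∑ t : F, c t • ContinuousLinearMap.proj (R := ℝ) t)
    refine this.congr (ae_of_all _ fun ω => ?_)
    simpa [mul_comm] using Finset.sum_coe_sort F fun t => X t ω * c t
  have hmean : ∫ ω, ∑ t ∈ F, X t ω * c t ∂P = 0 := by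
    rw [integral_finsetSum _ fun t _ => ((h2 t).integrable one_le_two).mul_const _]
    simp [integral_mul_const, h0]
  have hvar : Var[fun ω => ∑ t ∈ F, X t ω * c t; P] =
      ∑ s ∈ F, ∑ t ∈ F, (∫ ω, X s ω * X t ω ∂P) * c s * c t := by
    rw [variance_of_integral_eq_zero hlaw.aemeasurable hmean]
    simp_rw [sq, Finset.sum_mul_sum]
    rw [integral_finsetSum]
    · refine Finset.sum_congr rfl fun s _ => ?_
      rw [integral_finsetSum]
      · refine Finset.sum_congr rfl fun t _ => ?_
        rw [← integral_mul_const, ← integral_mul_const]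
        congr 1 with ω
        ring
      · intro t _
        exact (((hint s t).mul_const (c s)).mul_const (c t)).congr
          (ae_of_all _ fun ω => by ring)
    · intro s _
      refine integrable_finsetSum _ fun t _ => ?_
      exact (((hint s t).mul_const (c s)).mul_const (c t)).congr (ae_of_all _ fun ω => by ring)
  have hmap := hlaw.map_eq_gaussianReal
  have hchar := congrArg (fun ν => charFun ν 1) hmap
  simp only [charFun_gaussianReal] at hchar
  rw [hmean, charFun_apply, integral_map hlaw.aemeasurable (by fun_prop), Real.coe_toNNReal _ (variance_nonneg _ _),
    hvar] at hchar
  convert hchar using 2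
  · ext ω; simp
  · push_cast; simp; ring

/-- Discretizing time by a simple function `d` turns an integral of a path into a finite linear
combination of values of the process, with weights the integrals of `g` over the cells. -/
theorem integral_comp_simpleFunc_mul {T : Type*} [MeasurableSpace T] {ν : Measure T} {g : T → ℝ}
    (hg : Integrable g ν) (d : SimpleFunc T T) (f : T → ℝ) :
    ∫ t, f (d t) * g t ∂ν = ∑ y ∈ d.range, f y * ∫ t in d ⁻¹' {y}, g t ∂ν := by
  have h : ∀ t, f (d t) * g t = ∑ y ∈ d.range, f y * (d ⁻¹' {y}).indicator g t := by
    intro t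
    rw [Finset.sum_eq_single (d t)]
    · simp
    · intro y _ hy
      rw [Set.indicator_of_notMem (by simpa using hy.symm), mul_zero]
    · intro hd
      exact absurd (d.mem_range_self t) hd
  simp_rw [h]
  rw [integral_finsetSum]
  · refine Finset.sum_congr rfl fun y _ => ?_
    rw [integral_const_mul, integral_indicator (d.measurableSet_fiber y)]
  · intro y _
    exact (hg.indicator (d.measurableSet_fiber y)).const_mul _

variable {X : I → Ω → ℝ} {K : I → I → ℝ} {g : I → ℝ}

theorem tendsto_integral_comp_mul {f : I → ℝ} (hf : Continuous f) (hg : Integrable g)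
    {d : ℕ → SimpleFunc I I} (hd : ∀ t, Tendsto (fun n => d n t) atTop (𝓝 t)) :
    Tendsto (fun n => ∫ t, f (d n t) * g t) atTop (𝓝 (∫ t, f t * g t)) := by
  obtain ⟨C, hC⟩ := isCompact_univ.exists_bound_of_continuousOn hf.continuousOn
  refine tendsto_integral_of_dominated_convergence (fun t => C * ‖g t‖) (fun n => ?_)
    (hg.norm.const_mul C) (fun n => ae_of_all _ fun t => ?_) (ae_of_all _ fun t => ?_)
  · exact (hf.measurable.comp (d n).measurable).aestronglyMeasurable.mul hg.aestronglyMeasurable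
  · rw [norm_mul]
    exact mul_le_mul_of_nonneg_right (hC _ (Set.mem_univ _)) (norm_nonneg _)
  · exact ((hf.tendsto t).comp (hd t)).mul_const _

theorem ae_tendsto_integral_comp_mul (hc : ∀ᵐ ω ∂P, Continuous fun t => X t ω) (hg : Integrable g)
    {d : ℕ → SimpleFunc I I} (hd : ∀ t, Tendsto (fun n => d n t) atTop (𝓝 t)) :
    ∀ᵐ ω ∂P, Tendsto (fun n => ∑ y ∈ (d n).range, X y ω * ∫ t in d n ⁻¹' {y}, g t) atTop
      (𝓝 (∫ t, X t ω * g t)) := by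
  filter_upwards [hc] with ω hω
  refine (tendsto_integral_comp_mul hω hg hd).congr fun n => ?_
  rw [integral_comp_simpleFunc_mul hg (d n) fun t => X t ω]

theorem exists_simpleFunc_tendsto_id :
    ∃ d : ℕ → SimpleFunc I I, ∀ t, Tendsto (fun n => d n t) atTop (𝓝 t) :=
  ⟨_, (stronglyMeasurable_id (α := I)).tendsto_approx⟩

theorem aemeasurable_integral_mul (hX : ∀ t, AEMeasurable (X t) P)
    (hc : ∀ᵐ ω ∂P, Continuous fun t => X t ω) (hg : Integrable g) :
    AEMeasurable (fun ω => ∫ t, X t ω * g t) P := by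
  obtain ⟨d, hd⟩ := exists_simpleFunc_tendsto_id
  refine aemeasurable_of_tendsto_metrizable_ae' (fun n => ?_) (ae_tendsto_integral_comp_mul hc hg hd)
  exact Finset.aemeasurable_fun_sum _ fun t _ => (hX t).mul_const _

/-- The characteristic function of an integral of a centered Gaussian process. -/
theorem integral_cexp_integral_mul (hX : IsGaussianProcess X P) (h0 : ∀ t, ∫ ω, X t ω ∂P = 0)
    (hc : ∀ᵐ ω ∂P, Continuous fun t => X t ω) (hK : ∀ s t, ∫ ω, X s ω * X t ω ∂P = K s t)
    (hKc : Continuous fun p : I × I => K p.1 p.2) (hg : Integrable g) :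
    ∫ ω, Complex.exp ((∫ t, X t ω * g t : ℝ) * Complex.I) ∂P =
      Complex.exp (-(∫ t, (∫ s, K s t * g s) * g t : ℝ) / 2) := by
  have := hX.isProbabilityMeasure
  obtain ⟨d, hd⟩ := exists_simpleFunc_tendsto_id
  have h1 := tendsto_integral_cexp_of_tendsto_ae
    (fun n => Finset.aemeasurable_fun_sum _ fun t _ => (hX.aemeasurable t).mul_const _)
    (ae_tendsto_integral_comp_mul hc hg hd) 1
  simp only [one_mul, integral_cexp_sum_of_isGaussianProcess hX h0, hK] at h1
  refine tendsto_nhds_unique h1 ?_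
  refine ((by fun_prop : Continuous fun v : ℝ => Complex.exp (-(v : ℂ) / 2)).tendsto _).comp ?_
  obtain ⟨C, hC⟩ := isCompact_univ.exists_bound_of_continuousOn hKc.continuousOn
  have hC' : ∀ s t, ‖K s t‖ ≤ C := fun s t => hC (s, t) (Set.mem_univ _)
  -- The variances of the discretized integrals are these double integrals with both times replaced
  -- by `d n`; they converge by two nested dominated convergences, `K` being bounded.
  have h2 : Tendsto (fun n => ∫ t, (∫ s, K (d n s) (d n t) * g s) * g t) atTop
      (𝓝 (∫ t, (∫ s, K s t * g s) * g t)) := by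
    refine tendsto_integral_of_dominated_convergence (fun t => (∫ s, C * ‖g s‖) * ‖g t‖)
      (fun n => ?_) (hg.norm.const_mul _) (fun n => ae_of_all _ fun t => ?_)
      (ae_of_all _ fun t => ?_)
    · refine AEStronglyMeasurable.mul ?_ hg.aestronglyMeasurable
      have : Measurable fun y => ∫ s, K (d n s) y * g s := by
        have : (fun y => ∫ s, K (d n s) y * g s) =
            fun y => ∑ z ∈ (d n).range, K z y * ∫ s in d n ⁻¹' {z}, g s :=
          funext fun y => integral_comp_simpleFunc_mul hg (d n) fun z => K z y
        rw [this]
        refine Finset.measurable_fun_sum _ fun z _ => Measurable.mul_const ?_ _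
        exact (hKc.comp (Continuous.prodMk_right z)).measurable
      exact (this.comp (d n).measurable).aestronglyMeasurable
    · rw [norm_mul]
      refine mul_le_mul_of_nonneg_right ?_ (norm_nonneg _)
      refine norm_integral_le_of_norm_le (hg.norm.const_mul C) (ae_of_all _ fun s => ?_)
      rw [norm_mul]
      exact mul_le_mul_of_nonneg_right (hC' _ _) (norm_nonneg _)
    · refine Tendsto.mul_const _ ?_
      refine tendsto_integral_of_dominated_convergence (fun s => C * ‖g s‖) (fun n => ?_)
        (hg.norm.const_mul C) (fun n => ae_of_all _ fun s => ?_) (ae_of_all _ fun s => ?_)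
      · refine AEStronglyMeasurable.mul ?_ hg.aestronglyMeasurable
        exact ((hKc.comp (Continuous.prodMk_left (d n t))).measurable.comp
          (d n).measurable).aestronglyMeasurable
      · rw [norm_mul]
        exact mul_le_mul_of_nonneg_right (hC' _ _) (norm_nonneg _)
      · exact ((hKc.tendsto (s, t)).comp ((hd s).prodMk_nhds (hd t))).mul_const _
  refine h2.congr fun n => ?_
  rw [integral_comp_simpleFunc_mul hg (d n) fun y => ∫ s, K (d n s) y * g s, Finset.sum_comm]
  refine Finset.sum_congr rfl fun y _ => ?_
  rw [integral_comp_simpleFunc_mul hg (d n) fun z => K z y, Finset.sum_mul]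

end LinearFunctional

/-! ### Hilbert-Schmidt operators are compact -/

section HilbertSchmidt

open Filter Topology

variable {H F : Type*} [NormedAddCommGroup H] [InnerProductSpace ℝ H]
  [NormedAddCommGroup F] [InnerProductSpace ℝ F]

/-- The square of the Hilbert-Schmidt norm of `A` is at most `C`. -/
def HilbertSchmidtBound (A : H →L[ℝ] F) (C : ℝ) : Prop :=
  ∀ (n : ℕ) (v : Fin n → H), Orthonormal ℝ v → ∑ i, ‖A (v i)‖ ^ 2 ≤ C

theorem HilbertSchmidtBound.summable {A : H →L[ℝ] F} {C : ℝ} (hA : HilbertSchmidtBound A C)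
    {ι : Type*} {v : ι → H} (hv : Orthonormal ℝ v) : Summable fun i => ‖A (v i)‖ ^ 2 := by
  refine summable_of_sum_le (c := C) (fun _ => sq_nonneg _) fun s => ?_
  have := hA _ (fun i => v (s.equivFin.symm i))
    (hv.comp _ (Subtype.val_injective.comp s.equivFin.symm.injective))
  rwa [s.equivFin.symm.sum_comp fun i : s => ‖A (v i)‖ ^ 2,
    Finset.sum_coe_sort s fun i => ‖A (v i)‖ ^ 2] at this

/-- Truncations along a Hilbert basis have finite rank and converge in operator norm: by
Cauchy-Schwarz the error is controlled by the tail of `∑ ‖A (b i)‖²`. -/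
theorem HilbertSchmidtBound.isCompactOperator [CompleteSpace H] [CompleteSpace F] {A : H →L[ℝ] F}
    {C : ℝ} (hA : HilbertSchmidtBound A C) : IsCompactOperator A := by
  classical
  obtain ⟨w, b, -⟩ := exists_hilbertBasis ℝ H
  have hb := b.orthonormal
  have hsum := hA.summable hb
  let R : Finset w → H →L[ℝ] F := fun s =>
    ∑ i ∈ s, (ContinuousLinearMap.toSpanSingleton ℝ (A (b i))) ∘L (innerSL ℝ (b i))
  have hR : ∀ s h, R s h = ∑ i ∈ s, (inner ℝ (b i) h : ℝ) • A (b i) := by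
    intro s h
    simp [R]
  refine isCompactOperator_of_tendsto (l := atTop) (F := R) ?_ (Eventually.of_forall fun s => ?_)
  · rw [Metric.tendsto_atTop]
    intro ε hε
    obtain ⟨s, hs⟩ := summable_iff_vanishing_norm.1 hsum ((ε / 2) ^ 2) (by positivity)
    refine ⟨s, fun t hst => ?_⟩
    rw [dist_eq_norm]
    refine lt_of_le_of_lt ?_ (half_lt_self hε)
    refine ContinuousLinearMap.opNorm_le_bound _ (by positivity) fun h => ?_
    -- The error `R t h - A h` is estimated through finite differences `R t h - R r h`, which only
    -- involve indices in `r \ t`.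
    have hlim : Tendsto (fun r => ‖R t h - R r h‖) atTop (𝓝 ‖R t h - A h‖) := by
      refine (Tendsto.const_sub _ ?_).norm
      have := (b.hasSum_repr h).mapL A
      simp only [map_smul, b.repr_apply_apply] at this
      exact (tendsto_congr fun r => hR r h).2 this
    rw [sub_apply]
    refine le_of_tendsto hlim ((eventually_ge_atTop t).mono fun r hr => ?_)
    have h1 : R t h - R r h = - ∑ i ∈ r \ t, (inner ℝ (b i) h : ℝ) • A (b i) := by
      rw [hR, hR, ← Finset.sum_sdiff hr]
      abel
    have h2 : ∑ i ∈ r \ t, ‖A (b i)‖ ^ 2 ≤ (ε / 2) ^ 2 := by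
      have := hs (r \ t) (Finset.sdiff_disjoint.mono_right hst)
      rw [Real.norm_eq_abs] at this
      exact (le_abs_self _).trans this.le
    have h3 : ∑ i ∈ r \ t, ‖(inner ℝ (b i) h : ℝ)‖ ^ 2 ≤ ‖h‖ ^ 2 := hb.sum_inner_products_le h
    have h4 : (∑ i ∈ r \ t, ‖A (b i)‖ * ‖(inner ℝ (b i) h : ℝ)‖) ^ 2 ≤ (ε / 2 * ‖h‖) ^ 2 := by
      refine (Finset.sum_mul_sq_le_sq_mul_sq _ _ _).trans ?_
      rw [mul_pow]
      exact mul_le_mul h2 h3 (Finset.sum_nonneg fun _ _ => sq_nonneg _) (sq_nonneg _)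
    rw [h1, norm_neg]
    refine (norm_sum_le _ _).trans ?_
    refine le_trans (Finset.sum_le_sum fun i _ => ?_) (abs_le_of_sq_le_sq' h4 (by positivity)).2
    rw [norm_smul, mul_comm]
  · have : ∀ i, IsCompactOperator
        ((ContinuousLinearMap.toSpanSingleton ℝ (A (b i))) ∘L (innerSL ℝ (b i))) := fun i =>
      (isCompactOperator_of_locallyCompactSpace_rng
        (ContinuousLinearMap.toSpanSingleton ℝ (A (b i)))).comp_clm (innerSL ℝ (b i))
    exact (compactOperator (RingHom.id ℝ) H F).sum_mem fun i _ => this i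

end HilbertSchmidt

/-! ### Integral operators with square-integrable kernel -/

section KernelOperator

variable {α : Type*} [MeasurableSpace α] {μ : Measure α}

theorem _root_.MeasureTheory.MemLp.inner_toLp_eq {f : α → ℝ} (hf : MemLp f 2 μ) (h : Lp ℝ 2 μ) :
    inner ℝ (hf.toLp f) h = ∫ x, f x * h x ∂μ := by
  rw [L2.inner_def]
  refine integral_congr_ae ?_
  filter_upwards [hf.coeFn_toLp] with x hx
  rw [hx]
  simp [mul_comm]

theorem _root_.MeasureTheory.MemLp.norm_toLp_sq {f : α → ℝ} (hf : MemLp f 2 μ) :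
    ‖hf.toLp f‖ ^ 2 = ∫ x, f x ^ 2 ∂μ := by
  rw [← real_inner_self_eq_norm_sq, hf.inner_toLp_eq]
  refine integral_congr_ae ?_
  filter_upwards [hf.coeFn_toLp] with x hx
  rw [hx, sq]

theorem inner_Lp_eq (g h : Lp ℝ 2 μ) : inner ℝ g h = ∫ x, g x * h x ∂μ := by
  have := (Lp.memLp g).inner_toLp_eq h
  rwa [Lp.toLp_coeFn] at this

theorem memLp_mul_prod {f g : α → ℝ} (hf : MemLp f 2 μ) (hg : MemLp g 2 μ) :
    MemLp (fun p : α × α => f p.1 * g p.2) 2 (μ.prod μ) := by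
  refine (memLp_two_iff_integrable_sq ?_).2 ?_
  · exact hf.aestronglyMeasurable.comp_fst.mul hg.aestronglyMeasurable.comp_snd
  · simp only [mul_pow]
    exact hf.integrable_sq.mul_prod hg.integrable_sq

variable [SFinite μ] {κ : α → α → ℝ}

theorem ae_memLp_kernel (hκ : MemLp (Function.uncurry κ) 2 (μ.prod μ)) :
    ∀ᵐ t ∂μ, MemLp (κ t) 2 μ := by
  filter_upwards [hκ.aestronglyMeasurable.prodMk_left, hκ.integrable_sq.prod_right_ae] with t h1 h2
  exact (memLp_two_iff_integrable_sq h1).2 h2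

theorem integral_kernel_sq (hκ : MemLp (Function.uncurry κ) 2 (μ.prod μ)) :
    Integrable (fun t => ∫ x, κ t x ^ 2 ∂μ) μ :=
  hκ.integrable_sq.integral_prod_left

theorem memLp_swap (hκ : MemLp (Function.uncurry κ) 2 (μ.prod μ)) :
    MemLp (Function.uncurry fun t x => κ x t) 2 (μ.prod μ) :=
  hκ.comp_measurePreserving Measure.measurePreserving_swap

theorem ae_sq_integral_kernel_le (hκ : MemLp (Function.uncurry κ) 2 (μ.prod μ)) (h : Lp ℝ 2 μ) :
    ∀ᵐ t ∂μ, (∫ x, κ t x * h x ∂μ) ^ 2 ≤ (∫ x, κ t x ^ 2 ∂μ) * ‖h‖ ^ 2 := by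
  filter_upwards [ae_memLp_kernel hκ] with t ht
  rw [← ht.inner_toLp_eq, ← ht.norm_toLp_sq, ← mul_pow]
  exact sq_le_sq.2 ((abs_real_inner_le_norm _ _).trans (le_abs_self _))

theorem memLp_integral_kernel (hκ : MemLp (Function.uncurry κ) 2 (μ.prod μ)) (h : Lp ℝ 2 μ) :
    MemLp (fun t => ∫ x, κ t x * h x ∂μ) 2 μ := by
  have hm : AEStronglyMeasurable (fun t => ∫ x, κ t x * h x ∂μ) μ := by
    refine AEStronglyMeasurable.integral_prod_right' (f := fun p : α × α => κ p.1 p.2 * h p.2) ?_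
    exact hκ.aestronglyMeasurable.mul (Lp.aestronglyMeasurable h).comp_snd
  refine (memLp_two_iff_integrable_sq hm).2 ?_
  refine ((integral_kernel_sq hκ).mul_const (‖h‖ ^ 2)).mono' (hm.pow 2) ?_
  filter_upwards [ae_sq_integral_kernel_le hκ h] with t ht
  rwa [Real.norm_of_nonneg (sq_nonneg _)]

/-- The integral operator on `L²` with a square-integrable kernel. -/
def kernelOp (κ : α → α → ℝ) (hκ : MemLp (Function.uncurry κ) 2 (μ.prod μ)) :
    Lp ℝ 2 μ →L[ℝ] Lp ℝ 2 μ :=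
  LinearMap.mkContinuous
    { toFun := fun h => (memLp_integral_kernel hκ h).toLp _
      map_add' := fun g h => by
        rw [← MemLp.toLp_add, MemLp.toLp_eq_toLp_iff]
        filter_upwards [ae_memLp_kernel hκ] with t ht
        have hg : Integrable (fun x => κ t x * g x) μ := ht.integrable_mul (Lp.memLp g)
        have hh : Integrable (fun x => κ t x * h x) μ := ht.integrable_mul (Lp.memLp h)
        rw [Pi.add_apply, ← integral_add hg hh]
        refine integral_congr_ae ?_
        filter_upwards [Lp.coeFn_add g h] with x hx
        rw [hx, Pi.add_apply, mul_add]
      map_smul' := fun c h => by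
        rw [RingHom.id_apply, ← MemLp.toLp_const_smul, MemLp.toLp_eq_toLp_iff]
        refine Filter.Eventually.of_forall fun t => ?_
        rw [Pi.smul_apply, smul_eq_mul, ← integral_const_mul]
        refine integral_congr_ae ?_
        filter_upwards [Lp.coeFn_smul c h] with x hx
        rw [hx, Pi.smul_apply, smul_eq_mul]
        ring }
    √(∫ t, ∫ x, κ t x ^ 2 ∂μ ∂μ) fun h => by
      rw [LinearMap.coe_mk, AddHom.coe_mk]
      refine (abs_le_of_sq_le_sq' ?_ (by positivity)).2
      rw [(memLp_integral_kernel hκ h).norm_toLp_sq, mul_pow, Real.sq_sqrt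
        (integral_nonneg fun t => integral_nonneg fun x => sq_nonneg _), ← integral_mul_const]
      exact integral_mono_ae (memLp_integral_kernel hκ h).integrable_sq
        ((integral_kernel_sq hκ).mul_const _) (ae_sq_integral_kernel_le hκ h)

theorem coeFn_kernelOp (hκ : MemLp (Function.uncurry κ) 2 (μ.prod μ)) (h : Lp ℝ 2 μ) :
    kernelOp κ hκ h =ᵐ[μ] fun t => ∫ x, κ t x * h x ∂μ :=
  (memLp_integral_kernel hκ h).coeFn_toLp

theorem adjoint_kernelOp (hκ : MemLp (Function.uncurry κ) 2 (μ.prod μ)) :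
    ContinuousLinearMap.adjoint (kernelOp κ hκ) = kernelOp (fun t x => κ x t) (memLp_swap hκ) := by
  symm
  rw [ContinuousLinearMap.eq_adjoint_iff]
  intro g h
  have h1 : inner ℝ (kernelOp (fun t x => κ x t) (memLp_swap hκ) g) h =
      ∫ t, (∫ x, κ x t * g x ∂μ) * h t ∂μ := by
    rw [inner_Lp_eq]
    refine integral_congr_ae ?_
    filter_upwards [coeFn_kernelOp (memLp_swap hκ) g] with t ht
    rw [ht]
  have h2 : inner ℝ g (kernelOp κ hκ h) = ∫ t, g t * (∫ x, κ t x * h x ∂μ) ∂μ := by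
    rw [inner_Lp_eq]
    refine integral_congr_ae ?_
    filter_upwards [coeFn_kernelOp hκ h] with t ht
    rw [ht]
  rw [h1, h2]
  simp_rw [← integral_mul_const, ← integral_const_mul]
  rw [integral_integral_swap]
  · refine integral_congr_ae (Filter.Eventually.of_forall fun t => ?_)
    refine integral_congr_ae (Filter.Eventually.of_forall fun x => ?_)
    simp only
    ring
  · refine ((memLp_swap hκ).integrable_mul (memLp_mul_prod (Lp.memLp h) (Lp.memLp g))).congr ?_
    refine Filter.Eventually.of_forall fun p => ?_
    simp only [Pi.mul_apply, Function.uncurry]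
    ring

/-- Fubini identifies the kernel of `A A†`; this is the form in which a covariance function is
recognized. -/
theorem coeFn_kernelOp_adjoint (hκ : MemLp (Function.uncurry κ) 2 (μ.prod μ)) (h : Lp ℝ 2 μ) :
    (kernelOp κ hκ ∘L ContinuousLinearMap.adjoint (kernelOp κ hκ)) h =ᵐ[μ]
      fun t => ∫ s, (∫ x, κ s x * κ t x ∂μ) * h s ∂μ := by
  rw [ContinuousLinearMap.comp_apply, adjoint_kernelOp]
  filter_upwards [coeFn_kernelOp hκ (kernelOp (fun t x => κ x t) (memLp_swap hκ) h),
    ae_memLp_kernel hκ] with t ht htm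
  rw [ht]
  have h1 : ∫ x, κ t x * kernelOp (fun t x => κ x t) (memLp_swap hκ) h x ∂μ =
      ∫ x, ∫ s, κ t x * (κ s x * h s) ∂μ ∂μ := by
    refine integral_congr_ae ?_
    filter_upwards [coeFn_kernelOp (memLp_swap hκ) h] with x hx
    rw [hx, ← integral_const_mul]
  rw [h1, integral_integral_swap]
  · refine integral_congr_ae (Filter.Eventually.of_forall fun s => ?_)
    simp only
    rw [← integral_mul_const]
    refine integral_congr_ae (Filter.Eventually.of_forall fun x => ?_)
    simp only
    ring
  · refine ((memLp_swap hκ).integrable_mul (memLp_mul_prod htm (Lp.memLp h))).congr ?_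
    refine Filter.Eventually.of_forall fun p => ?_
    simp only [Pi.mul_apply, Function.uncurry]
    ring

/-- Bessel's inequality for each row `κ t`, integrated over `t`. -/
theorem hilbertSchmidtBound_kernelOp (hκ : MemLp (Function.uncurry κ) 2 (μ.prod μ)) :
    HilbertSchmidtBound (kernelOp κ hκ) (∫ t, ∫ x, κ t x ^ 2 ∂μ ∂μ) := by
  intro n v hv
  have h1 : ∀ i, ‖kernelOp κ hκ (v i)‖ ^ 2 = ∫ t, (∫ x, κ t x * v i x ∂μ) ^ 2 ∂μ := fun i =>
    (memLp_integral_kernel hκ (v i)).norm_toLp_sq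
  have h2 : ∀ i, Integrable (fun t => (∫ x, κ t x * v i x ∂μ) ^ 2) μ := fun i =>
    (memLp_integral_kernel hκ (v i)).integrable_sq
  simp_rw [h1]
  rw [← integral_finsetSum _ fun i _ => h2 i]
  refine integral_mono_ae (integrable_finsetSum _ fun i _ => h2 i) (integral_kernel_sq hκ) ?_
  filter_upwards [ae_memLp_kernel hκ] with t ht
  have := hv.sum_inner_products_le (s := Finset.univ) (ht.toLp _)
  rw [ht.norm_toLp_sq] at this
  refine le_trans (le_of_eq (Finset.sum_congr rfl fun i _ => ?_)) this
  rw [real_inner_comm, ht.inner_toLp_eq, Real.norm_eq_abs, sq_abs]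

end KernelOperator

/-! ### Integration on the unit interval -/

section UnitInterval

open Filter Topology

theorem integral_unitInterval (f : ℝ → ℝ) : ∫ t : I, f t = ∫ t in (0 : ℝ)..1, f t := by
  rw [intervalIntegral.integral_of_le zero_le_one, ← integral_Icc_eq_integral_Ioc]
  exact integral_subtype_comap measurableSet_Icc f

theorem integrable_unitInterval_iff {f : ℝ → ℝ} :
    Integrable (fun t : I => f t) ↔ IntervalIntegrable f volume 0 1 := by
  rw [intervalIntegrable_iff_integrableOn_Icc_of_le zero_le_one,
    integrableOn_iff_comap_subtypeVal measurableSet_Icc]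
  rfl

theorem ae_pos_unitInterval : ∀ᵐ t : I, 0 < (t : ℝ) := by
  have : ∀ᵐ t : I, t ≠ 0 := by
    rw [ae_iff]
    simp
  filter_upwards [this] with t ht
  exact unitInterval.pos_iff_ne_zero.2 ht

theorem integrable_rpow_unitInterval {r : ℝ} (hr : -1 < r) :
    Integrable fun t : I => (t : ℝ) ^ r :=
  integrable_unitInterval_iff.2 (intervalIntegral.intervalIntegrable_rpow' hr)

theorem rpow_sq (t : I) (γ : ℝ) : ((t : ℝ) ^ γ) ^ 2 = (t : ℝ) ^ (2 * γ) := by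
  rw [← Real.rpow_natCast, ← Real.rpow_mul t.2.1, mul_comm]
  norm_num

theorem memLp_rpow_unitInterval {γ : ℝ} (hγ : -(1 / 2) < γ) :
    MemLp (fun t : I => (t : ℝ) ^ γ) 2 := by
  refine (memLp_two_iff_integrable_sq
    (by fun_prop : Measurable fun t : I => (t : ℝ) ^ γ).aestronglyMeasurable).2 ?_
  simp_rw [rpow_sq]
  exact integrable_rpow_unitInterval (by linarith)

theorem integral_indicator_rpow {r : ℝ} (hr : -1 < r) (s : I) :
    ∫ x : I, (x : ℝ) ^ r * (if x ≤ s then 1 else 0) = (s : ℝ) ^ (r + 1) / (r + 1) := by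
  have h1 := integral_unitInterval fun x => x ^ r * (if x ≤ (s : ℝ) then 1 else 0)
  simp only [Subtype.coe_le_coe] at h1
  rw [h1, intervalIntegral.integral_of_le zero_le_one]
  have h2 : ∀ x : ℝ, x ^ r * (if x ≤ (s : ℝ) then 1 else 0) =
      (Set.Iic (s : ℝ)).indicator (fun x => x ^ r) x := by
    intro x
    by_cases h : x ≤ s <;> simp [h]
  simp_rw [h2]
  rw [setIntegral_indicator measurableSet_Iic, Set.Ioc_inter_Iic, min_eq_right s.2.2,
    ← intervalIntegral.integral_of_le s.2.1, integral_rpow (Or.inl hr),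
    Real.zero_rpow (by linarith), sub_zero]

theorem integral_indicator_Ici (x : I) : ∫ t : I, (if x ≤ t then (1 : ℝ) else 0) = 1 - x := by
  have : ∀ t : I, (if x ≤ t then (1 : ℝ) else 0) = (Set.Ici x).indicator 1 t := fun t => by
    by_cases h : x ≤ t <;> simp [h]
  simp_rw [this]
  rw [integral_indicator_one measurableSet_Ici, Measure.real, unitInterval.volume_Ici,
    ENNReal.toReal_ofReal (by linarith [x.2.2])]

/-- An integrable function whose integrals over all initial intervals coincide almost everywhere is
zero. -/
theorem ae_eq_zero_of_ae_setIntegral_Iic_eq {q : I → ℝ} (hq : Integrable q) {c : ℝ}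
    (h : ∀ᵐ t : I, ∫ x in Set.Iic t, q x = c) : q =ᵐ[volume] 0 := by
  have hcont : Continuous fun t : I => ∫ x in Set.Iic t, q x := by
    simp_rw [← integral_indicator measurableSet_Iic]
    refine continuous_iff_continuousAt.2 fun t => ?_
    refine continuousAt_of_dominated (bound := fun x => ‖q x‖)
      (Eventually.of_forall fun s => (hq.indicator measurableSet_Iic).aestronglyMeasurable)
      (Eventually.of_forall fun s => ae_of_all _ fun x => norm_indicator_le_norm_self _ _)
      hq.norm ?_
    have hne : ∀ᵐ x : I, x ≠ t := by
      rw [ae_iff]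
      simp
    filter_upwards [hne] with x hx
    rcases lt_or_gt_of_ne hx with hx | hx
    · refine continuousAt_const.congr (f := fun _ => q x) ?_
      filter_upwards [eventually_gt_nhds hx] with s hs
      rw [Set.indicator_of_mem (Set.mem_Iic.2 hs.le)]
    · refine continuousAt_const.congr (f := fun _ => (0 : ℝ)) ?_
      filter_upwards [eventually_lt_nhds hx] with s hs
      exact (Set.indicator_of_notMem (s := Set.Iic s) (fun h => absurd hs (not_lt.2 h)) q).symm
  -- A set of full measure meets every open interval; with continuity of the primitive, "almost
  -- every `t`" becomes "every `t`".
  have hdense : Dense {t : I | ∫ x in Set.Iic t, q x = c} := by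
    refine dense_of_exists_between fun a b hab => ?_
    by_contra hno
    push Not at hno
    have h1 : volume (Set.Ioo a b) = 0 := by
      refine measure_mono_null (fun t ht => ?_) (ae_iff.1 h)
      exact fun htc => hno t htc ht
    rw [unitInterval.volume_Ioo, ENNReal.ofReal_eq_zero] at h1
    have : (a : ℝ) < b := hab
    linarith
  have hall : ∀ t : I, ∫ x in Set.Iic t, q x = c := by
    have := hdense.closure_eq
    rw [(isClosed_eq hcont continuous_const).closure_eq] at this
    exact fun t => (this ▸ Set.mem_univ t : t ∈ {t : I | ∫ x in Set.Iic t, q x = c})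
  have hc : c = 0 := by
    rw [← hall 0, setIntegral_measure_zero]
    simp [unitInterval.volume_Iic]
  have hfin : ∀ f : I → ℝ, Integrable f → ∫⁻ x, ENNReal.ofReal (f x) ≠ ∞ := fun f hf =>
    hf.lintegral_lt_top.ne
  -- The positive and negative parts of `q` have equal integrals over every initial interval, and
  -- these intervals determine a finite measure.
  have hmeas : volume.withDensity (fun x => ENNReal.ofReal (q x)) =
      volume.withDensity fun x => ENNReal.ofReal (-q x) := by
    have : IsFiniteMeasure (volume.withDensity fun x => ENNReal.ofReal (q x)) :=
      isFiniteMeasure_withDensity (hfin q hq)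
    refine Measure.ext_of_Iic _ _ fun t => ?_
    rw [withDensity_apply _ measurableSet_Iic, withDensity_apply _ measurableSet_Iic]
    have h1 := integral_eq_lintegral_pos_part_sub_lintegral_neg_part (hq.restrict (s := Set.Iic t))
    rw [hall t, hc, eq_comm, sub_eq_zero] at h1
    refine (ENNReal.toReal_eq_toReal_iff' ?_ ?_).1 h1
    · exact hq.restrict.lintegral_lt_top.ne
    · exact hq.neg.restrict.lintegral_lt_top.ne
  have hneg : AEMeasurable (fun x => -q x) := hq.aemeasurable.neg
  rw [withDensity_eq_iff hq.aemeasurable.ennreal_ofReal hneg.ennreal_ofReal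
    (hfin q hq)] at hmeas
  filter_upwards [hmeas] with x hx
  rcases le_total 0 (q x) with h0 | h0
  · rw [ENNReal.ofReal_of_nonpos (neg_nonpos.2 h0), ENNReal.ofReal_eq_zero] at hx
    exact le_antisymm hx h0
  · rw [ENNReal.ofReal_of_nonpos h0, eq_comm, ENNReal.ofReal_eq_zero] at hx
    exact le_antisymm h0 (neg_nonpos.1 hx)

theorem not_finiteDimensional_Lp_unitInterval :
    ¬ FiniteDimensional ℝ (Lp ℝ 2 (volume : Measure I)) := by
  intro hfin
  obtain ⟨p, hp⟩ : ∃ p : ℕ → I, StrictAnti p := by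
    refine ⟨fun n => ⟨1 / (n + 1), by positivity, ?_⟩, fun m n hmn => ?_⟩
    · rw [div_le_one (by positivity)]
      linarith [n.cast_nonneg (α := ℝ)]
    · show (1 / (n + 1) : ℝ) < 1 / (m + 1)
      have : (m : ℝ) < n := by exact_mod_cast hmn
      exact one_div_lt_one_div_of_lt (by positivity) (by linarith)
  -- Disjoint intervals of positive length: their indicators are nonzero and pairwise orthogonal.
  let s : ℕ → Set I := fun n => Set.Ioc (p (n + 1)) (p n)
  have hs : ∀ n, MeasurableSet (s n) := fun n => measurableSet_Ioc
  have hsv : ∀ n, volume (s n) ≠ 0 := fun n => by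
    rw [unitInterval.volume_Ioc, Ne, ENNReal.ofReal_eq_zero, not_le, sub_pos]
    exact hp n.lt_succ_self
  let v : ℕ → Lp ℝ 2 (volume : Measure I) := fun n =>
    indicatorConstLp 2 (hs n) (measure_ne_top volume _) 1
  have hinner : ∀ m n, inner ℝ (v m) (v n) = volume.real (s n ∩ s m) := fun m n => by
    rw [L2.inner_indicatorConstLp_one, setIntegral_congr_ae (g := (s n).indicator fun _ => 1) (hs m)
      (indicatorConstLp_coeFn.mono fun x hx _ => hx), setIntegral_indicator (hs n),
      setIntegral_const, smul_eq_mul, mul_one, Set.inter_comm]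
  have hv : LinearIndependent ℝ v := by
    refine linearIndependent_of_ne_zero_of_inner_eq_zero (fun n h0 => ?_) fun m n hmn => ?_
    · have := hinner n n
      rw [h0, inner_zero_left, Set.inter_self, eq_comm, measureReal_eq_zero_iff] at this
      exact hsv n this
    · simp only [hinner]
      have : s n ∩ s m = ∅ := by
        rw [← Set.disjoint_iff_inter_eq_empty]
        exact (hp.antitone.pairwise_disjoint_on_Ioc_succ hmn).symm
      simp [this]
  exact not_finite_iff_infinite.2 (inferInstanceAs (Infinite ℕ)) hv.finite

end UnitInterval

/-! ### The kernel of `A` and the two covariance computations -/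

section Kernels

open Filter Topology

theorem integral_sub_sub_sub {α : Type*} [MeasurableSpace α] {μ : Measure α} {f₁ f₂ f₃ f₄ : α → ℝ}
    (h₁ : Integrable f₁ μ) (h₂ : Integrable f₂ μ) (h₃ : Integrable f₃ μ) (h₄ : Integrable f₄ μ) :
    ∫ x, ((f₁ x - f₂ x) - (f₃ x - f₄ x)) ∂μ =
      (∫ x, f₁ x ∂μ - ∫ x, f₂ x ∂μ) - (∫ x, f₃ x ∂μ - ∫ x, f₄ x ∂μ) := by
  rw [← integral_sub h₁ h₂, ← integral_sub h₃ h₄]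
  exact integral_sub (h₁.sub h₂) (h₃.sub h₄)

/-- The kernel `x^γ 1_{x ≤ t}`. -/
def volterraKernel (γ : ℝ) (t x : I) : ℝ := (x : ℝ) ^ γ * if x ≤ t then 1 else 0

/-- The kernel `x^γ (1_{x ≤ t} - (1 - x))`, obtained from `volterraKernel` by centering in `t`. -/
def centeredVolterraKernel (γ : ℝ) (t x : I) : ℝ :=
  (x : ℝ) ^ γ * ((if x ≤ t then 1 else 0) - (1 - x))

variable {γ : ℝ}

theorem centeredVolterraKernel_eq (t x : I) :
    centeredVolterraKernel γ t x = volterraKernel γ t x - (x : ℝ) ^ γ * (1 - x) := by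
  rw [centeredVolterraKernel, volterraKernel, mul_sub]

theorem measurable_indicator_le :
    Measurable fun p : I × I => if p.2 ≤ p.1 then (1 : ℝ) else 0 :=
  Measurable.ite (measurableSet_le measurable_snd measurable_fst) measurable_const measurable_const

theorem memLp_rpow_snd (hγ : -(1 / 2) < γ) :
    MemLp (fun p : I × I => (p.2 : ℝ) ^ γ) 2 (volume.prod volume) := by
  have := memLp_mul_prod (memLp_const (1 : ℝ) (μ := (volume : Measure I)) (p := 2))
    (memLp_rpow_unitInterval hγ)
  simpa using this

theorem memLp_volterraKernel (hγ : -(1 / 2) < γ) :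
    MemLp (Function.uncurry (volterraKernel γ)) 2 (volume.prod volume) := by
  refine (memLp_rpow_snd hγ).mono ?_ (ae_of_all _ fun p => ?_)
  · exact ((by fun_prop : Measurable fun p : I × I => (p.2 : ℝ) ^ γ).mul
      measurable_indicator_le).aestronglyMeasurable
  · rw [Function.uncurry, volterraKernel, norm_mul]
    refine mul_le_of_le_one_right (norm_nonneg _) ?_
    split_ifs <;> simp

theorem memLp_centeredVolterraKernel (hγ : -(1 / 2) < γ) :
    MemLp (Function.uncurry (centeredVolterraKernel γ)) 2 (volume.prod volume) := by
  refine (memLp_rpow_snd hγ).mono ?_ (ae_of_all _ fun p => ?_)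
  · exact ((by fun_prop : Measurable fun p : I × I => (p.2 : ℝ) ^ γ).mul
      (measurable_indicator_le.sub (by fun_prop))).aestronglyMeasurable
  · rw [Function.uncurry, centeredVolterraKernel, norm_mul]
    refine mul_le_of_le_one_right (norm_nonneg _) ?_
    have h1 := p.2.2.1
    have h2 := p.2.2.2
    rw [Real.norm_eq_abs, abs_le]
    split_ifs <;> constructor <;> linarith

theorem memLp_volterraKernel_apply (hγ : -(1 / 2) < γ) (t : I) :
    MemLp (volterraKernel γ t) 2 := by
  refine (memLp_rpow_unitInterval hγ).mono ?_ (ae_of_all _ fun x => ?_)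
  · exact ((by fun_prop : Measurable fun x : I => (x : ℝ) ^ γ).mul
      (measurable_indicator_le.comp (measurable_prodMk_left (x := t)))).aestronglyMeasurable
  · rw [volterraKernel, norm_mul]
    refine mul_le_of_le_one_right (norm_nonneg _) ?_
    split_ifs <;> simp

theorem memLp_rpow_mul_sub (hγ : -(1 / 2) < γ) :
    MemLp (fun x : I => (x : ℝ) ^ γ * (1 - x)) 2 := by
  refine (memLp_rpow_unitInterval hγ).mono ?_ (ae_of_all _ fun x => ?_)
  · exact (by fun_prop : Measurable fun x : I => (x : ℝ) ^ γ * (1 - x)).aestronglyMeasurable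
  · rw [norm_mul]
    refine mul_le_of_le_one_right (norm_nonneg _) ?_
    rw [Real.norm_eq_abs, abs_le]
    constructor <;> linarith [x.2.1, x.2.2]

theorem integrable_indicator_le (x : I) :
    Integrable fun t : I => if x ≤ t then (1 : ℝ) else 0 := by
  refine (integrable_const (1 : ℝ)).mono'
    (measurable_indicator_le.comp (measurable_prodMk_right (y := x))).aestronglyMeasurable
    (ae_of_all _ fun t => ?_)
  split_ifs <;> simp

/-- This mean over `t` is exactly what the centered kernel subtracts. -/
theorem integral_volterraKernel_left (x : I) :
    ∫ t, volterraKernel γ t x = (x : ℝ) ^ γ * (1 - x) := by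
  simp only [volterraKernel]
  rw [integral_const_mul, integral_indicator_Ici]

/-- The covariance function of `t^γ B(t)` is the kernel of `A† A`. -/
theorem integral_centeredVolterraKernel_left (x y : I) :
    ∫ t, centeredVolterraKernel γ t x * centeredVolterraKernel γ t y =
      (x : ℝ) ^ γ * (y : ℝ) ^ γ * (min (x : ℝ) y - x * y) := by
  -- The product of the two indicators is that of `max x y ≤ t`. After integration, `1 - max x y -
  -- (1 - x) * (1 - y) = min x y - x * y`, since `max x y + min x y = x + y`.
  have h1 : ∀ t : I, centeredVolterraKernel γ t x * centeredVolterraKernel γ t y =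
      (x : ℝ) ^ γ * (y : ℝ) ^ γ * (((if max x y ≤ t then (1 : ℝ) else 0)
        - (1 - x) * (if y ≤ t then (1 : ℝ) else 0)) -
        ((1 - y) * (if x ≤ t then (1 : ℝ) else 0) - (1 - x) * (1 - y))) := by
    intro t
    simp only [centeredVolterraKernel, max_le_iff]
    by_cases hx : x ≤ t <;> by_cases hy : y ≤ t <;> simp [hx, hy] <;> ring
  simp_rw [h1]
  have i1 := integrable_indicator_le (max x y)
  have i2 := (integrable_indicator_le y).const_mul (1 - (x : ℝ))
  have i3 := (integrable_indicator_le x).const_mul (1 - (y : ℝ))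
  have i4 := integrable_const (μ := (volume : Measure I)) ((1 - (x : ℝ)) * (1 - y))
  rw [integral_const_mul, integral_sub_sub_sub i1 i2 i3 i4, integral_const_mul, integral_const_mul, integral_indicator_Ici,
    integral_indicator_Ici, integral_indicator_Ici, integral_const]
  congr 1
  rcases le_total x y with h | h
  · have h' : (x : ℝ) ≤ y := h
    rw [max_eq_right h, min_eq_left h']
    simp
    ring
  · have h' : (y : ℝ) ≤ x := h
    rw [max_eq_left h, min_eq_right h']
    simp
    ring

theorem integral_volterraKernel_right (hγ : -(1 / 2) < γ) (s t : I) :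
    ∫ x, volterraKernel γ s x * volterraKernel γ t x =
      min (s : ℝ) t ^ (1 + 2 * γ) / (1 + 2 * γ) := by
  have h1 : ∀ x : I, volterraKernel γ s x * volterraKernel γ t x =
      (x : ℝ) ^ (2 * γ) * (if x ≤ min s t then 1 else 0) := by
    intro x
    rw [← rpow_sq]
    simp only [volterraKernel, le_min_iff]
    by_cases hs : x ≤ s <;> by_cases ht : x ≤ t <;> simp [hs, ht, sq]
  have h2 : ((min s t : I) : ℝ) = min (s : ℝ) t := by
    rcases le_total s t with h | h
    · rw [min_eq_left h, min_eq_left (show (s : ℝ) ≤ t from h)]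
    · rw [min_eq_right h, min_eq_right (show (t : ℝ) ≤ s from h)]
  simp_rw [h1]
  rw [integral_indicator_rpow (by linarith), h2, add_comm]

/-- The covariance function of `W_γ` is the kernel of `A A†`. -/
theorem integral_centeredVolterraKernel_right (hγ : -(1 / 2) < γ) (s t : I) :
    ∫ x, centeredVolterraKernel γ s x * centeredVolterraKernel γ t x =
      1 / (1 + 2 * γ) * (min (s : ℝ) t ^ (1 + 2 * γ) - (∫ u : I, min (u : ℝ) s ^ (1 + 2 * γ))
        - ((∫ u : I, min (u : ℝ) t ^ (1 + 2 * γ))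
          - ∫ v : I, ∫ u : I, min (u : ℝ) v ^ (1 + 2 * γ))) := by
  set m : I → ℝ := fun x => (x : ℝ) ^ γ * (1 - x) with hm
  have hmL : MemLp m 2 := memLp_rpow_mul_sub hγ
  have hv : ∀ t, MemLp (volterraKernel γ t) 2 := memLp_volterraKernel_apply hγ
  -- As `m` is the mean over `u` of the Volterra kernel, Fubini reduces every pairing with `m` to
  -- averages of uncentered pairings.
  have hfub : ∀ f : I → ℝ, MemLp f 2 →
      ∫ x, m x * f x = ∫ u, ∫ x, volterraKernel γ u x * f x := by
    intro f hf
    have hx : ∀ x, m x * f x = ∫ u, volterraKernel γ u x * f x := fun x => by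
      rw [integral_mul_const, integral_volterraKernel_left]
    simp_rw [hx]
    refine integral_integral_swap ?_
    refine ((memLp_swap (memLp_volterraKernel hγ)).integrable_mul
      (memLp_mul_prod hf (memLp_const 1))).congr (ae_of_all _ fun p => ?_)
    simp [Function.uncurry]
  have hms : ∀ s, ∫ x, m x * volterraKernel γ s x =
      ∫ u : I, min (u : ℝ) s ^ (1 + 2 * γ) / (1 + 2 * γ) := fun s => by
    rw [hfub _ (hv s)]
    simp_rw [integral_volterraKernel_right hγ]
  have hmm : ∫ x, m x * m x =
      ∫ v : I, ∫ u : I, min (u : ℝ) v ^ (1 + 2 * γ) / (1 + 2 * γ) := by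
    rw [hfub _ hmL]
    simp_rw [← hms, mul_comm]
  have hexp : ∀ x, centeredVolterraKernel γ s x * centeredVolterraKernel γ t x =
      (volterraKernel γ s x * volterraKernel γ t x - m x * volterraKernel γ s x) -
        (m x * volterraKernel γ t x - m x * m x) := fun x => by
    rw [centeredVolterraKernel_eq, centeredVolterraKernel_eq, hm]
    ring
  simp_rw [hexp]
  have i1 : Integrable fun x => volterraKernel γ s x * volterraKernel γ t x :=
    (hv s).integrable_mul (hv t)
  have i2 : ∀ s, Integrable fun x => m x * volterraKernel γ s x := fun s =>
    hmL.integrable_mul (hv s)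
  have i3 : Integrable fun x => m x * m x := hmL.integrable_mul hmL
  rw [integral_sub_sub_sub i1 (i2 s) (i2 t) i3, hms, hms, hmm, integral_volterraKernel_right hγ]
  simp_rw [integral_div]
  ring

/-- `A h (t)` is the primitive of `x^γ h(x)` minus a constant. If it vanishes, the primitive is
constant, so `x^γ h(x) = 0` almost everywhere and `x^γ > 0` can be cancelled. -/
theorem injective_kernelOp_centeredVolterraKernel (hγ : -(1 / 2) < γ) :
    Function.Injective
      (kernelOp (centeredVolterraKernel γ) (memLp_centeredVolterraKernel hγ)) := by
  rw [injective_iff_map_eq_zero]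
  intro h hh
  have hq : Integrable fun x : I => (x : ℝ) ^ γ * h x :=
    (memLp_rpow_unitInterval hγ).integrable_mul (Lp.memLp h)
  have hm : Integrable fun x : I => (x : ℝ) ^ γ * (1 - x) * h x :=
    (memLp_rpow_mul_sub hγ).integrable_mul (Lp.memLp h)
  have h0 := coeFn_kernelOp (memLp_centeredVolterraKernel hγ) h
  rw [hh] at h0
  have h1 : ∀ᵐ t : I, ∫ x in Set.Iic t, (x : ℝ) ^ γ * h x =
      ∫ x : I, (x : ℝ) ^ γ * (1 - x) * h x := by
    filter_upwards [h0, Lp.coeFn_zero ℝ 2 (volume : Measure I)] with t ht ht0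
    rw [ht0, Pi.zero_apply] at ht
    have hexp : ∀ x, centeredVolterraKernel γ t x * h x =
        (Set.Iic t).indicator (fun x : I => (x : ℝ) ^ γ * h x) x -
          (x : ℝ) ^ γ * (1 - x) * h x := by
      intro x
      rw [centeredVolterraKernel]
      by_cases hx : x ≤ t
      · rw [Set.indicator_of_mem (Set.mem_Iic.2 hx), if_pos hx]
        ring
      · rw [Set.indicator_of_notMem (s := Set.Iic t) hx, if_neg hx]
        ring
    simp_rw [hexp] at ht
    rw [integral_sub (hq.indicator measurableSet_Iic) hm, integral_indicator measurableSet_Iic] at ht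
    linarith
  have h2 := ae_eq_zero_of_ae_setIntegral_Iic_eq hq h1
  rw [Lp.eq_zero_iff_ae_eq_zero]
  filter_upwards [h2, ae_pos_unitInterval] with x hx hx0
  exact (mul_eq_zero.1 hx).resolve_left (Real.rpow_pos_of_pos hx0 γ).ne'

end Kernels

/-! ### From processes on `[0,1]` to random elements of `L²[0,1]` -/

section Paths

open Filter Topology

variable {Ω Ω' : Type*} {ζ : I → Ω → ℝ} {ζ' : I → Ω' → ℝ}
  {S S' : Lp ℝ 2 (volume : Measure I) →L[ℝ] Lp ℝ 2 (volume : Measure I)}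
  {μ : ℕ → ℝ}

open Classical in
/-- The path of a process, as an element of `L²[0, 1]`. -/
def pathLp (ζ : I → Ω → ℝ) (ω : Ω) : Lp ℝ 2 (volume : Measure I) :=
  if h : MemLp (fun t => ζ t ω) 2 volume then h.toLp _ else 0

theorem inner_pathLp {ω : Ω} (hω : MemLp (fun t => ζ t ω) 2 volume)
    (h : Lp ℝ 2 (volume : Measure I)) : inner ℝ h (pathLp ζ ω) = ∫ t, ζ t ω * h t := by
  rw [pathLp, dif_pos hω, real_inner_comm, hω.inner_toLp_eq]

theorem norm_pathLp_sq {ω : Ω} (hω : MemLp (fun t => ζ t ω) 2 volume) :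
    ‖pathLp ζ ω‖ ^ 2 = ∫ t, ζ t ω ^ 2 := by
  rw [pathLp, dif_pos hω, hω.norm_toLp_sq]

variable [MeasurableSpace Ω] [MeasurableSpace Ω'] {P : Measure Ω} {P' : Measure Ω'}

/-- The default value `0` of `pathLp` is taken only on a null set, so it is invisible to
measurability and to the expectations. -/
theorem hasCovarianceOperator_pathLp (hζ : ∀ᵐ ω ∂P, MemLp (fun t => ζ t ω) 2 volume)
    (hm : ∀ h : Lp ℝ 2 (volume : Measure I), AEMeasurable (fun ω => ∫ t, ζ t ω * h t) P)
    (hc : ∀ h : Lp ℝ 2 (volume : Measure I),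
      ∫ ω, Complex.exp ((∫ t, ζ t ω * h t : ℝ) * Complex.I) ∂P =
        Complex.exp (-(inner ℝ h (S h) : ℝ) / 2)) : HasCovarianceOperator (pathLp ζ) P S := by
  have h1 : ∀ h : Lp ℝ 2 (volume : Measure I),
      (fun ω => ∫ t, ζ t ω * h t) =ᵐ[P] fun ω => inner ℝ h (pathLp ζ ω) := fun h => by
    filter_upwards [hζ] with ω hω
    rw [inner_pathLp hω]
  refine ⟨fun h => (hm h).congr (h1 h), fun h => ?_⟩
  rw [← hc h]
  refine integral_congr_ae ?_
  filter_upwards [h1 h] with ω hω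
  rw [hω]

theorem quadEq_of_hasCovarianceOperator [IsProbabilityMeasure P] [IsProbabilityMeasure P']
    (hζ : ∀ᵐ ω ∂P, MemLp (fun t => ζ t ω) 2 volume)
    (hζ' : ∀ᵐ ω ∂P', MemLp (fun t => ζ' t ω) 2 volume)
    (hS : HasCovarianceOperator (pathLp ζ) P S) (hS' : HasCovarianceOperator (pathLp ζ') P' S')
    {e e' : ℕ → Lp ℝ 2 (volume : Measure I)} (he : IsEigenSystem S μ e)
    (he' : IsEigenSystem S' μ e') : QuadEq ζ P ζ' P' := by
  -- Gives separability of `L²[0,1]`, needed for the norm expansion.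
  have : Fact ((2 : ℝ≥0∞) ≠ ∞) := ⟨by simp⟩
  have hid := hS.identDistrib_norm_sq he hS' he'
  refine ⟨hζ, hζ', ?_⟩
  have h1 : (fun ω => ‖pathLp ζ ω‖ ^ 2) =ᵐ[P] fun ω => ∫ t, ζ t ω ^ 2 :=
    hζ.mono fun ω hω => norm_pathLp_sq hω
  have h2 : (fun ω => ‖pathLp ζ' ω‖ ^ 2) =ᵐ[P'] fun ω => ∫ t, ζ' t ω ^ 2 :=
    hζ'.mono fun ω hω => norm_pathLp_sq hω
  refine ⟨hid.aemeasurable_fst.congr h1, hid.aemeasurable_snd.congr h2, ?_⟩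
  rw [← Measure.map_congr h1, ← Measure.map_congr h2, hid.map_eq]

/-- Passes from almost everywhere identities between functions to identities in `L²`, where
existence and uniqueness of eigensystems apply. -/
theorem isKLEigenvalues_iff
    (hK : MemLp (fun p : I × I => covKernel ζ P p.1 p.2) 2 (volume : Measure (I × I)))
    (hS : ∀ h : Lp ℝ 2 (volume : Measure I), S h =ᵐ[volume] fredholm ζ P h) :
    IsKLEigenvalues ζ P μ ↔ ∃ e, IsEigenSystem S μ e := by
  constructor
  · rintro ⟨-, hanti, hnn, e, he, heig, hker⟩
    refine ⟨e, hanti, hnn, he, fun k => ?_, fun h hh => ?_⟩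
    · refine Lp.ext ?_
      filter_upwards [hS (e k), heig k, Lp.coeFn_smul (μ k) (e k)] with t h1 h2 h3
      rw [h1, h2, h3, Pi.smul_apply, smul_eq_mul]
    · rw [Lp.eq_zero_iff_ae_eq_zero]
      filter_upwards [hS h, hker h hh] with t h1 h2
      rw [h1, h2, Pi.zero_apply]
  · rintro ⟨e, he⟩
    refine ⟨hK, he.antitone, he.nonneg, e, he.orthonormal, fun k => ?_, fun h hh => ?_⟩
    · have := hS (e k)
      rw [he.apply_eq] at this
      filter_upwards [this, Lp.coeFn_smul (μ k) (e k)] with t h1 h2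
      rw [← h1, h2, Pi.smul_apply, smul_eq_mul]
    · have := hS h
      rw [he.apply_eq_zero h hh] at this
      filter_upwards [this, Lp.coeFn_zero ℝ 2 (volume : Measure I)] with t h1 h2
      rw [← h1, h2, Pi.zero_apply]

end Paths

/-! ### Joint measurability and exchange of expectation with time integrals -/

section Fubini

open Filter Topology

variable {Ω : Type*} [MeasurableSpace Ω] {P : Measure Ω} {X : I → Ω → ℝ}

/-- The discretizations `X (d n t) ω` are finite sums of products of a function of `t` and one of
`ω`, and converge by continuity of the paths. -/
theorem aemeasurable_uncurry_of_ae_continuous (hX : ∀ t, AEMeasurable (X t) P)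
    (hc : ∀ᵐ ω ∂P, Continuous fun t => X t ω) :
    AEMeasurable (Function.uncurry X) (volume.prod P) := by
  obtain ⟨d, hd⟩ := exists_simpleFunc_tendsto_id
  have hc' : ∀ᵐ p ∂((volume : Measure I).prod P), Continuous fun t => X t p.2 :=
    Measure.quasiMeasurePreserving_snd.ae hc
  refine aemeasurable_of_tendsto_metrizable_ae' (f := fun n p => X (d n p.1) p.2) (fun n => ?_) ?_
  · have h : (fun p : I × Ω => X (d n p.1) p.2) = fun p =>
        ∑ y ∈ (d n).range, (d n ⁻¹' {y}).indicator (fun _ => (1 : ℝ)) p.1 * X y p.2 := by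
      ext p
      rw [Finset.sum_eq_single (d n p.1)]
      · simp
      · intro y _ hy
        rw [Set.indicator_of_notMem (by simpa using hy.symm), zero_mul]
      · intro h
        exact absurd ((d n).mem_range_self p.1) h
    rw [h]
    refine Finset.aemeasurable_fun_sum _ fun y _ => AEMeasurable.mul ?_ ?_
    · exact ((measurable_const.indicator ((d n).measurableSet_fiber y)).comp
        measurable_fst).aemeasurable
    · exact (hX y).comp_snd
  · filter_upwards [hc'] with p hp
    exact (hp.tendsto p.1).comp (hd p.1)

variable [SFinite P] {K : I → I → ℝ}

theorem memLp_uncurry_of_ae_continuous (hX : ∀ t, MemLp (X t) 2 P)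
    (hc : ∀ᵐ ω ∂P, Continuous fun t => X t ω) (hK : ∀ s t, ∫ ω, X s ω * X t ω ∂P = K s t)
    (hKc : Continuous fun p : I × I => K p.1 p.2) :
    MemLp (Function.uncurry X) 2 (volume.prod P) := by
  have hm := (aemeasurable_uncurry_of_ae_continuous
    (fun t => (hX t).aestronglyMeasurable.aemeasurable) hc).aestronglyMeasurable
  refine (memLp_two_iff_integrable_sq hm).2 ((integrable_prod_iff (hm.pow 2)).2 ⟨?_, ?_⟩)
  · exact ae_of_all _ fun t => (hX t).integrable_sq
  · have : (fun t => ∫ ω, ‖(Function.uncurry X ^ 2) (t, ω)‖ ∂P) = fun t => K t t := by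
      ext t
      rw [← hK]
      refine integral_congr_ae (ae_of_all _ fun ω => ?_)
      simp [Function.uncurry, sq]
    rw [this]
    exact (hKc.comp (by fun_prop : Continuous fun t : I => (t, t))).integrable_of_hasCompactSupport
      (HasCompactSupport.of_compactSpace _)

theorem memLp_integral_of_memLp_uncurry (hX : MemLp (Function.uncurry X) 2 (volume.prod P)) :
    MemLp (fun ω => ∫ t, X t ω) 2 P := by
  have hm : AEStronglyMeasurable (fun ω => ∫ t, X t ω) P :=
    hX.aestronglyMeasurable.prod_swap.integral_prod_right'
  refine (memLp_two_iff_integrable_sq hm).2 ?_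
  have hsw : Integrable (fun p : Ω × I => X p.2 p.1 ^ 2) (P.prod volume) := hX.integrable_sq.swap
  refine hsw.integral_prod_left.mono' (hm.pow 2) ?_
  filter_upwards [hsw.prod_right_ae, hX.aestronglyMeasurable.prod_swap.prodMk_left] with ω hω hmω
  have h2 : MemLp (fun t => X t ω) 2 (volume : Measure I) := (memLp_two_iff_integrable_sq hmω).2 hω
  -- Nonnegativity of the variance over the probability space `[0,1]` is the inequality `(∫ X)² ≤ ∫
  -- X²`.
  have hv := variance_nonneg (fun t => X t ω) (volume : Measure I)
  rw [variance_eq_sub h2] at hv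
  rw [Real.norm_of_nonneg (sq_nonneg _)]
  simpa using hv

theorem integral_mul_integral_of_memLp_uncurry
    (hX : MemLp (Function.uncurry X) 2 (volume.prod P)) {Y : Ω → ℝ} (hY : MemLp Y 2 P) :
    ∫ ω, Y ω * (∫ t, X t ω) ∂P = ∫ t, ∫ ω, X t ω * Y ω ∂P := by
  have h1 : MemLp (fun p : I × Ω => Y p.2) 2 (volume.prod P) :=
    hY.comp_measurePreserving measurePreserving_snd
  have h2 : Integrable (Function.uncurry fun t ω => X t ω * Y ω) (volume.prod P) :=
    hX.integrable_mul h1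
  rw [integral_integral_swap h2]
  refine integral_congr_ae (ae_of_all _ fun ω => ?_)
  simp only
  rw [integral_mul_const, mul_comm]

end Fubini

/-! ### The factorizing operator `A` and its eigensystems -/

open Filter Topology

variable {γ : ℝ}

theorem memLp_mul_of_continuous {f g : I → ℝ} (hf : Continuous f) (hg : MemLp g 2 volume) :
    MemLp (fun t => g t * f t) 2 volume := by
  obtain ⟨C, hC⟩ := isCompact_univ.exists_bound_of_continuousOn hf.continuousOn
  refine (hg.mul_const C).mono (hg.aestronglyMeasurable.mul hf.aestronglyMeasurable)
    (ae_of_all _ fun t => ?_)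
  rw [norm_mul, norm_mul]
  exact mul_le_mul_of_nonneg_left ((hC t (Set.mem_univ t)).trans (le_abs_self C)) (norm_nonneg _)

/-- The integral operator on `L²[0, 1]` with kernel `x^γ (1_{x ≤ t} - (1 - x))`. -/
def centeredVolterraOp (hγ : -(1 / 2) < γ) :
    Lp ℝ 2 (volume : Measure I) →L[ℝ] Lp ℝ 2 (volume : Measure I) :=
  kernelOp (centeredVolterraKernel γ) (memLp_centeredVolterraKernel hγ)

theorem coeFn_centeredVolterraOp_adjoint (hγ : -(1 / 2) < γ) (h : Lp ℝ 2 (volume : Measure I)) :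
    (centeredVolterraOp hγ ∘L ContinuousLinearMap.adjoint (centeredVolterraOp hγ)) h =ᵐ[volume]
      fun t => ∫ s, (∫ x, centeredVolterraKernel γ s x * centeredVolterraKernel γ t x) * h s :=
  coeFn_kernelOp_adjoint _ h

theorem coeFn_adjoint_centeredVolterraOp (hγ : -(1 / 2) < γ) (h : Lp ℝ 2 (volume : Measure I)) :
    (ContinuousLinearMap.adjoint (centeredVolterraOp hγ) ∘L centeredVolterraOp hγ) h =ᵐ[volume]
      fun t => ∫ s : I, ((s : ℝ) ^ γ * (t : ℝ) ^ γ * (min (s : ℝ) t - s * t)) * h s := by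
  -- `A† A` has the form `C C†` with `C = A†`, whose kernel is the transposed one.
  have h1 := coeFn_kernelOp_adjoint (memLp_swap (memLp_centeredVolterraKernel hγ)) h
  rw [adjoint_kernelOp] at h1
  simp_rw [integral_centeredVolterraKernel_left] at h1
  rw [centeredVolterraOp, adjoint_kernelOp]
  exact h1

theorem exists_isEigenSystem_centeredVolterraOp (hγ : -(1 / 2) < γ) :
    ∃ μ e f, IsEigenSystem
        (ContinuousLinearMap.adjoint (centeredVolterraOp hγ) ∘L centeredVolterraOp hγ) μ e ∧
      IsEigenSystem
        (centeredVolterraOp hγ ∘L ContinuousLinearMap.adjoint (centeredVolterraOp hγ)) μ f := by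
  have hHS := hilbertSchmidtBound_kernelOp (memLp_centeredVolterraKernel hγ)
  obtain ⟨μ, e, he⟩ := exists_isEigenSystem hHS.isCompactOperator
    not_finiteDimensional_Lp_unitInterval fun e he => hHS.summable he
  obtain ⟨f, hf⟩ := he.exists_apply_adjoint (injective_kernelOp_centeredVolterraKernel hγ)
  exact ⟨μ, e, f, he, hf⟩

/-! ### The weighted bridge has covariance operator `A† A` -/

section Bridge

variable {Ω : Type*} [MeasurableSpace Ω] {P : Measure Ω} {B : I → Ω → ℝ}

theorem IsBrownianBridge.covKernel_weightedBridge (hB : IsBrownianBridge B P) (s t : I) :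
    covKernel (weightedBridge γ B) P s t =
      (s : ℝ) ^ γ * (t : ℝ) ^ γ * (min (s : ℝ) t - s * t) := by
  rw [covKernel, ← hB.covariance_eq, ← integral_const_mul]
  refine integral_congr_ae (ae_of_all _ fun ω => ?_)
  simp only [weightedBridge]
  ring

theorem IsBrownianBridge.memLp_covKernel (hB : IsBrownianBridge B P) (hγ : -(1 / 2) < γ) :
    MemLp (fun p : I × I => covKernel (weightedBridge γ B) P p.1 p.2) 2 volume := by
  simp_rw [hB.covKernel_weightedBridge]
  refine (memLp_mul_prod (memLp_rpow_unitInterval hγ) (memLp_rpow_unitInterval hγ)).mono ?_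
    (ae_of_all _ fun p => ?_)
  · exact (by fun_prop : Measurable fun p : I × I => (p.1 : ℝ) ^ γ * (p.2 : ℝ) ^ γ *
      (min (p.1 : ℝ) p.2 - p.1 * p.2)).aestronglyMeasurable
  · rw [norm_mul]
    refine mul_le_of_le_one_right (norm_nonneg _) ?_
    have h1 := p.1.2.1
    have h2 := p.1.2.2
    have h3 := p.2.2.1
    have h4 := p.2.2.2
    have h5 : (p.1 : ℝ) * p.2 ≤ 1 := mul_le_one₀ h2 h3 h4
    have h6 : 0 ≤ (p.1 : ℝ) * p.2 := mul_nonneg h1 h3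
    have h7 : 0 ≤ min (p.1 : ℝ) p.2 := le_min h1 h3
    have h8 : min (p.1 : ℝ) p.2 ≤ 1 := (min_le_left _ _).trans h2
    rw [Real.norm_eq_abs, abs_le]
    constructor <;> linarith

theorem IsBrownianBridge.ae_memLp (hB : IsBrownianBridge B P) (hγ : -(1 / 2) < γ) :
    ∀ᵐ ω ∂P, MemLp (fun t => weightedBridge γ B t ω) 2 volume := by
  filter_upwards [hB.continuous_paths] with ω hω
  exact memLp_mul_of_continuous hω (memLp_rpow_unitInterval hγ)

/-- The weight `t^γ`, possibly unbounded at `0`, is moved onto the test function, so that the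
Gaussian computation concerns only `B`, with continuous paths and covariance. -/
theorem IsBrownianBridge.hasCovarianceOperator (hB : IsBrownianBridge B P) (hγ : -(1 / 2) < γ) :
    HasCovarianceOperator (pathLp (weightedBridge γ B)) P
      (ContinuousLinearMap.adjoint (centeredVolterraOp hγ) ∘L centeredVolterraOp hγ) := by
  have hg : ∀ h : Lp ℝ 2 (volume : Measure I), Integrable fun t : I => (t : ℝ) ^ γ * h t :=
    fun h => (memLp_rpow_unitInterval hγ).integrable_mul (Lp.memLp h)
  have hrw : ∀ (h : Lp ℝ 2 (volume : Measure I)) ω, ∫ t, weightedBridge γ B t ω * h t =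
      ∫ t : I, B t ω * ((t : ℝ) ^ γ * h t) := fun h ω =>
    integral_congr_ae (ae_of_all _ fun t => by simp only [weightedBridge]; ring)
  refine hasCovarianceOperator_pathLp (hB.ae_memLp hγ) (fun h => ?_) fun h => ?_
  · simp_rw [hrw]
    exact aemeasurable_integral_mul hB.isGaussianProcess.aemeasurable hB.continuous_paths (hg h)
  · simp_rw [hrw]
    rw [integral_cexp_integral_mul hB.isGaussianProcess hB.integral_eq_zero hB.continuous_paths
      hB.covariance_eq (by fun_prop) (hg h), inner_Lp_eq]
    congr 4
    refine integral_congr_ae ?_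
    filter_upwards [coeFn_adjoint_centeredVolterraOp hγ h] with t ht
    rw [ht, mul_comm (h t), ← mul_assoc, mul_comm (∫ s, _) ((t : ℝ) ^ γ), ← integral_const_mul]
    congr 1
    refine integral_congr_ae (ae_of_all _ fun s => ?_)
    simp only
    ring

end Bridge

/-! ### The mean-centered Wiener process has covariance operator `A A†` -/

section Wiener

variable {Ω : Type*} {W : ℝ≥0 → Ω → ℝ}

/-- The time-changed process `W(t^a)`, for `t ∈ [0, 1]`. -/
def timeChange (W : ℝ≥0 → Ω → ℝ) (a : ℝ) (t : I) (ω : Ω) : ℝ :=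
  W (unitInterval.toNNReal t ^ a) ω

variable {a : ℝ}

theorem continuous_timeChange (ha : 0 < a) {ω : Ω} (hω : Continuous fun t => W t ω) :
    Continuous fun t => timeChange W a t ω :=
  hω.comp ((NNReal.continuous_rpow_const ha.le).comp unitInterval.toNNReal_continuous)

theorem meanCenteredWiener_eq (t : I) (ω : Ω) : meanCenteredWiener γ W t ω =
    1 / √(1 + 2 * γ) * (timeChange W (1 + 2 * γ) t ω - ∫ u, timeChange W (1 + 2 * γ) u ω) := rfl

theorem continuous_meanCenteredWiener (hγ : -(1 / 2) < γ) {ω : Ω}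
    (hω : Continuous fun t => W t ω) : Continuous fun t => meanCenteredWiener γ W t ω := by
  simp_rw [meanCenteredWiener_eq]
  exact continuous_const.mul ((continuous_timeChange (by linarith) hω).sub continuous_const)

variable [MeasurableSpace Ω] {P : Measure Ω}

theorem _root_.ProbabilityTheory.IsPreBrownianReal.integral_mul (hW : IsPreBrownianReal W P)
    (s t : ℝ≥0) : ∫ ω, W s ω * W t ω ∂P = min (s : ℝ) t := by
  have := hW.isGaussianProcess.isProbabilityMeasure
  have h := hW.covariance_eval s t
  rw [covariance_eq_sub (hW.isGaussianProcess.hasGaussianLaw_eval s).memLp_two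
    (hW.isGaussianProcess.hasGaussianLaw_eval t).memLp_two, hW.integral_eval] at h
  simpa using h

theorem isGaussianProcess_timeChange (hW : IsPreBrownianReal W P) :
    IsGaussianProcess (timeChange W a) P :=
  hW.isGaussianProcess.comp_right fun t : I => unitInterval.toNNReal t ^ a

theorem integral_timeChange (hW : IsPreBrownianReal W P) (t : I) :
    ∫ ω, timeChange W a t ω ∂P = 0 :=
  hW.integral_eval _

theorem integral_timeChange_mul (hW : IsPreBrownianReal W P) (ha : 0 < a) (s t : I) :
    ∫ ω, timeChange W a s ω * timeChange W a t ω ∂P = min (s : ℝ) t ^ a := by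
  simp only [timeChange]
  rw [hW.integral_mul]
  simp only [NNReal.coe_rpow, unitInterval.coe_toNNReal]
  exact ((Real.monotoneOn_rpow_Ici_of_exponent_nonneg ha.le).map_min s.2.1 t.2.1).symm

theorem continuous_min_rpow (ha : 0 < a) :
    Continuous fun p : I × I => min (p.1 : ℝ) p.2 ^ a := by
  have : 0 ≤ a := ha.le
  fun_prop (disch := assumption)

/-- Expanding the product and exchanging expectation with the time averages gives the same four
terms as `integral_centeredVolterraKernel_right`. -/
theorem covKernel_meanCenteredWiener (hW : IsBrownianReal W P) (hγ : -(1 / 2) < γ) (s t : I) :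
    covKernel (meanCenteredWiener γ W) P s t =
      ∫ x, centeredVolterraKernel γ s x * centeredVolterraKernel γ t x := by
  have ha : 0 < 1 + 2 * γ := by linarith
  have hP := hW.isGaussianProcess.isProbabilityMeasure
  have hV : ∀ t, MemLp (timeChange W (1 + 2 * γ) t) 2 P := fun t =>
    ((isGaussianProcess_timeChange hW.toIsPreBrownianReal).hasGaussianLaw_eval t).memLp_two
  have hcov := integral_timeChange_mul hW.toIsPreBrownianReal ha
  have hVu := memLp_uncurry_of_ae_continuous hV
    (hW.cont.mono fun ω hω => continuous_timeChange ha hω) hcov (continuous_min_rpow ha)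
  have hM := memLp_integral_of_memLp_uncurry hVu
  have hMV : ∀ s, ∫ ω, timeChange W (1 + 2 * γ) s ω * (∫ u, timeChange W (1 + 2 * γ) u ω) ∂P =
      ∫ u : I, min (u : ℝ) s ^ (1 + 2 * γ) := fun s => by
    rw [integral_mul_integral_of_memLp_uncurry hVu (hV s)]
    simp_rw [hcov]
  have hMM : ∫ ω, (∫ u, timeChange W (1 + 2 * γ) u ω) * (∫ u, timeChange W (1 + 2 * γ) u ω) ∂P =
      ∫ v : I, ∫ u : I, min (u : ℝ) v ^ (1 + 2 * γ) := by
    rw [integral_mul_integral_of_memLp_uncurry hVu hM]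
    simp_rw [hMV]
  have i1 : Integrable (fun ω => timeChange W (1 + 2 * γ) s ω * timeChange W (1 + 2 * γ) t ω) P :=
    (hV s).integrable_mul (hV t)
  have i2 : ∀ s, Integrable
      (fun ω => timeChange W (1 + 2 * γ) s ω * ∫ u, timeChange W (1 + 2 * γ) u ω) P := fun s =>
    (hV s).integrable_mul hM
  have i3 : Integrable (fun ω => (∫ u, timeChange W (1 + 2 * γ) u ω) *
      ∫ u, timeChange W (1 + 2 * γ) u ω) P := hM.integrable_mul hM
  rw [integral_centeredVolterraKernel_right hγ, ← hcov s t, ← hMV s, ← hMV t, ← hMM,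
    ← integral_sub_sub_sub i1 (i2 s) (i2 t) i3, ← integral_const_mul, covKernel]
  refine integral_congr_ae (ae_of_all _ fun ω => ?_)
  simp only [meanCenteredWiener_eq]
  have hsq : 1 / (1 + 2 * γ) = 1 / √(1 + 2 * γ) * (1 / √(1 + 2 * γ)) := by
    rw [div_mul_div_comm, Real.mul_self_sqrt ha.le, one_mul]
  rw [hsq]
  ring

theorem memLp_covKernel_meanCenteredWiener (hW : IsBrownianReal W P) (hγ : -(1 / 2) < γ) :
    MemLp (fun p : I × I => covKernel (meanCenteredWiener γ W) P p.1 p.2) 2 volume := by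
  have ha : 0 < 1 + 2 * γ := by linarith
  have hcm := continuous_min_rpow ha
  have h1 : Continuous fun s : I => ∫ u : I, min (u : ℝ) s ^ (1 + 2 * γ) := by
    have := continuous_parametric_integral_of_continuous (μ := (volume : Measure I))
      (f := fun s u : I => min (u : ℝ) s ^ (1 + 2 * γ)) (hcm.comp continuous_swap)
      (s := Set.univ) isCompact_univ
    simpa using this
  simp_rw [covKernel_meanCenteredWiener hW hγ, integral_centeredVolterraKernel_right hγ]
  have hc : Continuous fun p : I × I => 1 / (1 + 2 * γ) *
      (min (p.1 : ℝ) p.2 ^ (1 + 2 * γ) - (∫ u : I, min (u : ℝ) p.1 ^ (1 + 2 * γ))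
        - ((∫ u : I, min (u : ℝ) p.2 ^ (1 + 2 * γ))
          - ∫ v : I, ∫ u : I, min (u : ℝ) v ^ (1 + 2 * γ))) :=
    continuous_const.mul ((hcm.sub (h1.comp continuous_fst)).sub
      ((h1.comp continuous_snd).sub continuous_const))
  obtain ⟨C, hC⟩ := isCompact_univ.exists_bound_of_continuousOn hc.continuousOn
  exact MemLp.of_bound hc.aestronglyMeasurable C (ae_of_all _ fun p => hC p (Set.mem_univ p))

theorem ae_memLp_meanCenteredWiener (hW : IsBrownianReal W P) (hγ : -(1 / 2) < γ) :
    ∀ᵐ ω ∂P, MemLp (fun t => meanCenteredWiener γ W t ω) 2 volume := by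
  filter_upwards [hW.cont] with ω hω
  simpa using memLp_mul_of_continuous (continuous_meanCenteredWiener hγ hω) (memLp_const (1 : ℝ))

/-- Centering is a self-adjoint projection: with `A₀` the uncentered Volterra operator and `g = h -
∫ h`, one has `A† h = A₀† g`. So `⟨h, A A† h⟩ = ⟨g, A₀ A₀† g⟩`, and `A₀ A₀†` has kernel
`min(s,t)^(1+2γ) / (1+2γ)`. -/
theorem integral_integral_min_rpow_eq_inner (hγ : -(1 / 2) < γ)
    (h : Lp ℝ 2 (volume : Measure I)) :
    ∫ t : I, (∫ s : I, min (s : ℝ) t ^ (1 + 2 * γ) * (1 / √(1 + 2 * γ) * (h s - ∫ u, h u))) *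
        (1 / √(1 + 2 * γ) * (h t - ∫ u, h u)) =
      inner ℝ h
        ((centeredVolterraOp hγ ∘L ContinuousLinearMap.adjoint (centeredVolterraOp hγ)) h) := by
  have ha : 0 < 1 + 2 * γ := by linarith
  have hh : Integrable h := (Lp.memLp h).integrable one_le_two
  have hgL : MemLp (fun t => h t - ∫ u, h u) 2 volume := (Lp.memLp h).sub (memLp_const _)
  set g := hgL.toLp _ with hg
  have hgc : g =ᵐ[volume] fun t => h t - ∫ u, h u := hgL.coeFn_toLp
  set A₀ := kernelOp (volterraKernel γ) (memLp_volterraKernel hγ) with hA₀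
  have hadj : ContinuousLinearMap.adjoint A₀ g =
      ContinuousLinearMap.adjoint (centeredVolterraOp hγ) h := by
    refine Lp.ext ?_
    rw [hA₀, centeredVolterraOp, adjoint_kernelOp, adjoint_kernelOp]
    filter_upwards [coeFn_kernelOp (memLp_swap (memLp_volterraKernel hγ)) g,
      coeFn_kernelOp (memLp_swap (memLp_centeredVolterraKernel hγ)) h,
      ae_memLp_kernel (memLp_swap (memLp_volterraKernel hγ))] with x h1 h2 hx
    rw [h1, h2]
    have h3 : ∫ t, volterraKernel γ t x * g t =
        ∫ t, (volterraKernel γ t x * h t - volterraKernel γ t x * ∫ u, h u) := by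
      refine integral_congr_ae ?_
      filter_upwards [hgc] with t ht
      rw [ht, mul_sub]
    have i1 : Integrable fun t => volterraKernel γ t x * h t := hx.integrable_mul (Lp.memLp h)
    have i2 : Integrable fun t => volterraKernel γ t x * ∫ u, h u :=
      (hx.integrable one_le_two).mul_const _
    rw [h3, integral_sub i1 i2, integral_mul_const, integral_volterraKernel_left,
      ← integral_const_mul, ← integral_sub i1 (hh.const_mul _)]
    refine integral_congr_ae (ae_of_all _ fun t => ?_)
    simp only [centeredVolterraKernel_eq]
    ring
  rw [ContinuousLinearMap.comp_apply, ← ContinuousLinearMap.adjoint_inner_left, ← hadj,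
    ContinuousLinearMap.adjoint_inner_left, ← ContinuousLinearMap.comp_apply, inner_Lp_eq]
  refine integral_congr_ae ?_
  filter_upwards [coeFn_kernelOp_adjoint (memLp_volterraKernel hγ) g, hgc] with t ht hgt
  have hsq : 1 / (1 + 2 * γ) = 1 / √(1 + 2 * γ) * (1 / √(1 + 2 * γ)) := by
    rw [div_mul_div_comm, Real.mul_self_sqrt ha.le, one_mul]
  have h4 : ∫ s : I, (∫ x, volterraKernel γ s x * volterraKernel γ t x) * g s =
      1 / √(1 + 2 * γ) *
        ∫ s : I, min (s : ℝ) t ^ (1 + 2 * γ) * (1 / √(1 + 2 * γ) * (h s - ∫ u, h u)) := by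
    rw [← integral_const_mul]
    refine integral_congr_ae ?_
    filter_upwards [hgc] with s hs
    rw [integral_volterraKernel_right hγ, hs, div_eq_mul_one_div, hsq]
    ring
  rw [ht, h4, hgt]
  ring

theorem hasCovarianceOperator_meanCenteredWiener (hW : IsBrownianReal W P)
    (hγ : -(1 / 2) < γ) : HasCovarianceOperator (pathLp (meanCenteredWiener γ W)) P
      (centeredVolterraOp hγ ∘L ContinuousLinearMap.adjoint (centeredVolterraOp hγ)) := by
  have ha : 0 < 1 + 2 * γ := by linarith
  have hGP := isGaussianProcess_timeChange (a := 1 + 2 * γ) hW.toIsPreBrownianReal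
  have hcont : ∀ᵐ ω ∂P, Continuous fun t => timeChange W (1 + 2 * γ) t ω :=
    hW.cont.mono fun ω hω => continuous_timeChange ha hω
  have hh : ∀ h : Lp ℝ 2 (volume : Measure I), Integrable h := fun h =>
    (Lp.memLp h).integrable one_le_two
  have hg : ∀ h : Lp ℝ 2 (volume : Measure I),
      Integrable fun t => 1 / √(1 + 2 * γ) * (h t - ∫ u, h u) := fun h =>
    ((hh h).sub (integrable_const _)).const_mul _
  -- The centering of the process is moved onto the test function, leaving an integral of the
  -- Gaussian process `W(t^(1+2γ))`.
  have hrw : ∀ h : Lp ℝ 2 (volume : Measure I),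
      (fun ω => ∫ t, timeChange W (1 + 2 * γ) t ω * (1 / √(1 + 2 * γ) * (h t - ∫ u, h u))) =ᵐ[P]
        fun ω => ∫ t, meanCenteredWiener γ W t ω * h t := fun h => by
    filter_upwards [hcont] with ω hω
    have i0 : Integrable fun t => timeChange W (1 + 2 * γ) t ω := by
      simpa using (memLp_mul_of_continuous hω (memLp_const (1 : ℝ))).integrable one_le_two
    have i1 : Integrable fun t => timeChange W (1 + 2 * γ) t ω * h t := by
      refine ((memLp_mul_of_continuous hω (Lp.memLp h)).integrable one_le_two).congr
        (ae_of_all _ fun t => mul_comm _ _)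
    set M := ∫ u, timeChange W (1 + 2 * γ) u ω with hM
    set m := ∫ u, h u with hm
    set c := 1 / √(1 + 2 * γ) with hc
    have e1 : ∫ t, timeChange W (1 + 2 * γ) t ω * (c * (h t - m)) =
        c * ((∫ t, timeChange W (1 + 2 * γ) t ω * h t) - M * m) := by
      rw [hM, ← integral_mul_const, ← integral_sub i1 (i0.mul_const m), ← integral_const_mul]
      exact integral_congr_ae (ae_of_all _ fun t => by simp only; ring)
    have e2 : ∫ t, meanCenteredWiener γ W t ω * h t =
        c * ((∫ t, timeChange W (1 + 2 * γ) t ω * h t) - M * m) := by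
      rw [← integral_const_mul M, ← integral_sub i1 ((hh h).const_mul M), ← integral_const_mul]
      exact integral_congr_ae (ae_of_all _ fun t => by
        simp only [meanCenteredWiener_eq, ← hM, ← hc]; ring)
    rw [e1, e2]
  refine hasCovarianceOperator_pathLp (ae_memLp_meanCenteredWiener hW hγ) (fun h => ?_) fun h => ?_
  · exact (aemeasurable_integral_mul hGP.aemeasurable hcont (hg h)).congr (hrw h)
  · rw [← integral_integral_min_rpow_eq_inner, ← integral_cexp_integral_mul hGP
      (integral_timeChange hW.toIsPreBrownianReal) hcont
      (integral_timeChange_mul hW.toIsPreBrownianReal ha) (continuous_min_rpow ha) (hg h)]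
    refine integral_congr_ae ?_
    filter_upwards [hrw h] with ω hω
    rw [hω]

end Wiener

/-! ### The substitution `s = t^(1+2γ)` and the bridge `W(t) - t W(1)` -/

theorem integral_comp_toNNReal_rpow {a : ℝ} (ha : 0 < a) (F : ℝ≥0 → ℝ) :
    ∫ t : I, F (unitInterval.toNNReal t ^ a) =
      1 / a * ∫ s : I, (s : ℝ) ^ (1 / a - 1) * F (unitInterval.toNNReal s) := by
  -- Both integrals are extended by zero to the half-line, where the substitution `t = x^(1/a)` is
  -- made; it preserves the condition `x ≤ 1`.
  have hset : ∀ f : ℝ → ℝ, ∫ t : I, f t = ∫ t in Set.Ioi 0, (Set.Iic 1).indicator f t := by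
    intro f
    rw [integral_unitInterval, intervalIntegral.integral_of_le zero_le_one,
      setIntegral_indicator measurableSet_Iic, Set.Ioi_inter_Iic]
  have h1 := hset fun t => F (t.toNNReal ^ a)
  have h2 := hset fun s => s ^ (1 / a - 1) * F s.toNNReal
  have hnn : ∀ t : I, (t : ℝ).toNNReal = unitInterval.toNNReal t := fun t => by
    rw [← unitInterval.coe_toNNReal, Real.toNNReal_coe]
  simp only [hnn] at h1 h2
  rw [h1, h2, ← integral_comp_rpow_Ioi _ (one_div_pos.2 ha).ne', ← integral_const_mul]
  refine setIntegral_congr_fun measurableSet_Ioi fun x hx => ?_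
  have hx0 : (0 : ℝ) < x := hx
  have hpow : (x ^ (1 / a)).toNNReal ^ a = x.toNNReal := by
    rw [Real.toNNReal_rpow_of_nonneg hx0.le, ← NNReal.rpow_mul, one_div_mul_cancel ha.ne',
      NNReal.rpow_one]
  have hle : x ^ (1 / a) ≤ 1 ↔ x ≤ 1 := by
    have := Real.rpow_le_rpow_iff hx0.le zero_le_one (one_div_pos.2 ha)
    rwa [Real.one_rpow] at this
  simp only [smul_eq_mul, abs_of_pos (one_div_pos.2 ha)]
  by_cases h : x ≤ 1
  · rw [Set.indicator_of_mem (Set.mem_Iic.2 h), Set.indicator_of_mem (Set.mem_Iic.2 (hle.2 h)),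
      hpow, mul_assoc]
  · rw [Set.indicator_of_notMem (mt Set.mem_Iic.1 h),
      Set.indicator_of_notMem (mt Set.mem_Iic.1 (mt hle.1 h)), mul_zero, mul_zero]

theorem one_div_sub_one (hγ : -(1 / 2) < γ) : 1 / (1 + 2 * γ) - 1 = -2 * γ / (1 + 2 * γ) := by
  have ha : 1 + 2 * γ ≠ 0 := by linarith
  field_simp
  ring

/-- The substitution is applied both to the inner mean and to the outer integral; the second factor
`1 / (1 + 2γ)` is the squared normalization of `W_γ`. -/
theorem integral_meanCenteredWiener_sq {Ω : Type*} {W : ℝ≥0 → Ω → ℝ} (hγ : -(1 / 2) < γ) (ω : Ω) :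
    ∫ t : I, meanCenteredWiener γ W t ω ^ 2 =
      1 / (1 + 2 * γ) ^ 2 *
        ∫ t : I, (t : ℝ) ^ (-2 * γ / (1 + 2 * γ)) *
          (W (unitInterval.toNNReal t) ω - 1 / (2 * γ + 1) *
            ∫ s : I, (s : ℝ) ^ (-2 * γ / (1 + 2 * γ)) * W (unitInterval.toNNReal s) ω) ^ 2 := by
  have ha : 0 < 1 + 2 * γ := by linarith
  rw [add_comm (2 * γ) 1, ← one_div_sub_one hγ, ← integral_comp_toNNReal_rpow ha fun x => W x ω]
  set M := ∫ u : I, W (unitInterval.toNNReal u ^ (1 + 2 * γ)) ω with hM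
  have h := integral_comp_toNNReal_rpow ha fun x => 1 / (1 + 2 * γ) * (W x ω - M) ^ 2
  have hl : ∫ t : I, meanCenteredWiener γ W t ω ^ 2 =
      ∫ t : I, 1 / (1 + 2 * γ) * (W (unitInterval.toNNReal t ^ (1 + 2 * γ)) ω - M) ^ 2 := by
    refine integral_congr_ae (ae_of_all _ fun t => ?_)
    simp only [meanCenteredWiener, ← hM]
    rw [mul_pow, div_pow, Real.sq_sqrt ha.le, one_pow]
  rw [hl, h, ← integral_const_mul, ← integral_const_mul]
  refine integral_congr_ae (ae_of_all _ fun t => ?_)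
  simp only
  field_simp

theorem integral_weightedBridge_sq {Ω : Type*} (B : I → Ω → ℝ) (ω : Ω) :
    ∫ t : I, weightedBridge γ B t ω ^ 2 = ∫ t : I, (t : ℝ) ^ (2 * γ) * B t ω ^ 2 :=
  integral_congr_ae (ae_of_all _ fun t => by simp only [weightedBridge, mul_pow, rpow_sq])

theorem isBrownianBridge_of_isBrownianReal {Ω : Type*} [MeasurableSpace Ω] {P : Measure Ω}
    {W : ℝ≥0 → Ω → ℝ} (hW : IsBrownianReal W P) :
    IsBrownianBridge (fun (t : I) ω => W (unitInterval.toNNReal t) ω - t * W 1 ω) P where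
  isGaussianProcess := by
    refine hW.isGaussianProcess.of_isGaussianProcess fun t => ?_
    exact ⟨{unitInterval.toNNReal t, 1},
      { toFun := fun x => x ⟨unitInterval.toNNReal t, by simp⟩ - t * x ⟨1, by simp⟩
        map_add' := fun x y => by simp only [Pi.add_apply]; ring
        map_smul' := fun c x => by
          simp only [Pi.smul_apply, smul_eq_mul, RingHom.id_apply]; ring }, fun ω => rfl⟩
  integral_eq_zero t := by
    rw [integral_sub (hW.integrable_eval _) ((hW.integrable_eval _).const_mul _),
      integral_const_mul, hW.integral_eval, hW.integral_eval]
    simp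
  covariance_eq s t := by
    have h2 : ∀ s, MemLp (W s) 2 P := fun s =>
      (hW.isGaussianProcess.hasGaussianLaw_eval s).memLp_two
    have hi : ∀ s t, Integrable (fun ω => W s ω * W t ω) P := fun s t =>
      (h2 s).integrable_mul (h2 t)
    have hexp : ∀ ω, (W (unitInterval.toNNReal s) ω - s * W 1 ω) *
        (W (unitInterval.toNNReal t) ω - t * W 1 ω) =
        (W (unitInterval.toNNReal s) ω * W (unitInterval.toNNReal t) ω -
          t * (W (unitInterval.toNNReal s) ω * W 1 ω)) -
        (s * (W 1 ω * W (unitInterval.toNNReal t) ω) - s * t * (W 1 ω * W 1 ω)) := fun ω => by ring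
    simp_rw [hexp]
    rw [integral_sub_sub_sub (hi _ _) ((hi _ _).const_mul _) ((hi _ _).const_mul _)
      ((hi _ _).const_mul _), integral_const_mul, integral_const_mul, integral_const_mul,
      hW.integral_mul, hW.integral_mul, hW.integral_mul, hW.integral_mul]
    simp only [unitInterval.coe_toNNReal, NNReal.coe_one, min_self, min_eq_left s.2.2,
      min_eq_right t.2.2]
    ring
  continuous_paths := by
    filter_upwards [hW.cont] with ω hω
    have := hω.comp unitInterval.toNNReal_continuous
    exact this.sub (by fun_prop)

theorem quadEq_meanCenteredWiener_weightedBridge {Ω Ω' : Type*} [MeasurableSpace Ω]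
    [MeasurableSpace Ω'] {P : Measure Ω} {P' : Measure Ω'} {W : ℝ≥0 → Ω → ℝ}
    (hW : IsBrownianReal W P) {B : I → Ω' → ℝ} (hB : IsBrownianBridge B P') (hγ : -(1 / 2) < γ) :
    QuadEq (meanCenteredWiener γ W) P (weightedBridge γ B) P' := by
  have := hW.isGaussianProcess.isProbabilityMeasure
  have := hB.isGaussianProcess.isProbabilityMeasure
  obtain ⟨μ, e, f, he, hf⟩ := exists_isEigenSystem_centeredVolterraOp hγ
  exact quadEq_of_hasCovarianceOperator (ae_memLp_meanCenteredWiener hW hγ) (hB.ae_memLp hγ)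
    (hasCovarianceOperator_meanCenteredWiener hW hγ) (hB.hasCovarianceOperator hγ) hf he

theorem integrable_mul_of_continuous {f g : I → ℝ} (hf : Continuous f) (hg : Integrable g) :
    Integrable fun t => g t * f t := by
  obtain ⟨C, hC⟩ := isCompact_univ.exists_bound_of_continuousOn hf.continuousOn
  exact hg.mul_bdd (c := C) hf.aestronglyMeasurable (ae_of_all _ fun t => hC t (Set.mem_univ t))

end KLWiener

end

/-! ### The theorem -/

theorem mainTheorem2
    {Ω Ω' : Type*} [MeasurableSpace Ω] [MeasurableSpace Ω']
    (P : Measure Ω) (P' : Measure Ω')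
    (W : ℝ≥0 → Ω → ℝ) (hW : IsBrownianReal W P)
    (B : I → Ω' → ℝ) (hB : KLWiener.IsBrownianBridge B P')
    (γ : ℝ) (hγ : -(1 / 2) < γ) :
    -- the `L²` norms have the same law
    KLWiener.QuadEq (KLWiener.meanCenteredWiener γ W) P (KLWiener.weightedBridge γ B) P' ∧
    -- the sequences of Karhunen-Loève eigenvalues exist, are unique, and coincide
    (∃ ev : ℕ → ℝ, ∀ μ : ℕ → ℝ,
      (KLWiener.IsKLEigenvalues (KLWiener.meanCenteredWiener γ W) P μ ↔ μ = ev) ∧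
      (KLWiener.IsKLEigenvalues (KLWiener.weightedBridge γ B) P' μ ↔ μ = ev)) ∧
    -- the explicit identity in law, all integrals being almost surely well defined
    ((∀ᵐ ω ∂P,
        Integrable (fun s : I =>
          (s : ℝ) ^ (-2 * γ / (1 + 2 * γ)) * W (unitInterval.toNNReal s) ω) ∧
        Integrable (fun t : I => (t : ℝ) ^ (-2 * γ / (1 + 2 * γ)) *
          (W (unitInterval.toNNReal t) ω - 1 / (2 * γ + 1) *
            ∫ s : I, (s : ℝ) ^ (-2 * γ / (1 + 2 * γ)) * W (unitInterval.toNNReal s) ω) ^ 2) ∧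
        Integrable (fun t : I => (t : ℝ) ^ (2 * γ) *
          (W (unitInterval.toNNReal t) ω - (t : ℝ) * W 1 ω) ^ 2)) ∧
      IdentDistrib
        (fun ω => 1 / (1 + 2 * γ) ^ 2 *
          ∫ t : I, (t : ℝ) ^ (-2 * γ / (1 + 2 * γ)) *
            (W (unitInterval.toNNReal t) ω - 1 / (2 * γ + 1) *
              ∫ s : I, (s : ℝ) ^ (-2 * γ / (1 + 2 * γ)) * W (unitInterval.toNNReal s) ω) ^ 2)
        (fun ω => ∫ t : I, (t : ℝ) ^ (2 * γ) *
          (W (unitInterval.toNNReal t) ω - (t : ℝ) * W 1 ω) ^ 2) P P) := by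
  have ha : 0 < 1 + 2 * γ := by linarith
  obtain ⟨ev, e, f, he, hf⟩ := KLWiener.exists_isEigenSystem_centeredVolterraOp hγ
  refine ⟨KLWiener.quadEq_meanCenteredWiener_weightedBridge hW hB hγ, ⟨ev, fun μ => ⟨?_, ?_⟩⟩, ?_, ?_⟩
  · rw [KLWiener.isKLEigenvalues_iff (KLWiener.memLp_covKernel_meanCenteredWiener hW hγ)
      (S := KLWiener.centeredVolterraOp hγ ∘L
        ContinuousLinearMap.adjoint (KLWiener.centeredVolterraOp hγ))]
    · exact ⟨fun ⟨_, h⟩ => h.unique hf, fun h => ⟨f, h ▸ hf⟩⟩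
    · intro h
      filter_upwards [KLWiener.coeFn_centeredVolterraOp_adjoint hγ h] with t ht
      rw [ht, KLWiener.fredholm]
      simp_rw [KLWiener.covKernel_meanCenteredWiener hW hγ]
  · rw [KLWiener.isKLEigenvalues_iff (hB.memLp_covKernel hγ)
      (S := ContinuousLinearMap.adjoint (KLWiener.centeredVolterraOp hγ) ∘L
        KLWiener.centeredVolterraOp hγ)]
    · exact ⟨fun ⟨_, h⟩ => h.unique he, fun h => ⟨e, h ▸ he⟩⟩
    · intro h
      filter_upwards [KLWiener.coeFn_adjoint_centeredVolterraOp hγ h] with t ht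
      rw [ht, KLWiener.fredholm]
      simp_rw [hB.covKernel_weightedBridge]
  -- The exponent equals `1 / (1 + 2γ) - 1`, so the weight is integrable and the continuous path
  -- factors are bounded.
  · have h1 : -1 < -2 * γ / (1 + 2 * γ) := by
      rw [← KLWiener.one_div_sub_one hγ]
      linarith [one_div_pos.2 ha]
    filter_upwards [hW.cont] with ω hω
    have hc : Continuous fun t : I => W (unitInterval.toNNReal t) ω :=
      hω.comp unitInterval.toNNReal_continuous
    exact ⟨KLWiener.integrable_mul_of_continuous hc (KLWiener.integrable_rpow_unitInterval h1),
      KLWiener.integrable_mul_of_continuous ((hc.sub continuous_const).pow 2)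
        (KLWiener.integrable_rpow_unitInterval h1),
      KLWiener.integrable_mul_of_continuous ((hc.sub (by fun_prop)).pow 2)
        (KLWiener.integrable_rpow_unitInterval (by linarith))⟩
  -- The equality of norms is used with the bridge built from `W` itself, on the same probability
  -- space; no joint law of the two sides is involved.
  · have h := (KLWiener.quadEq_meanCenteredWiener_weightedBridge hW
      (KLWiener.isBrownianBridge_of_isBrownianReal hW) hγ).identDistrib
    simp_rw [KLWiener.integral_meanCenteredWiener_sq hγ, KLWiener.integral_weightedBridge_sq] at h
    exact h
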